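/- Let $\alpha\in[-\tfrac12,0]$ and let $(S_n)_{n\ge0}$ be the random walk on $\mathbb N=\{0,1,2,\dots\}$ associated with the Gegenbauer polynomials of index $\alpha$ and with $\mu=\delta_1$, that is, the birth and death Markov chain with transition probabilities $p(0,1)=1$ and, for $i\ge1$, $$p(i,i+1)=\frac{i+2\alpha+1}{2i+2\alpha+1},\qquad p(i,i-1)=\frac{i}{2i+2\alpha+1}.$$ Let $\mathbb P_x$ be the law of the chain started from $x\in\mathbb N$, and let $N_n(y)=\sum_{k=0}^n \mathbf 1_{\{S_k=y\}}$ be its local time at $y\in\mathbb N$. For $a\in\,]0,1[$ let $\mathcal M(a)$ denote the Mittag-Leffler distribution, the unique probability distribution on $[0,\infty[$ with Laplace transform $s\mapsto\sum_{p\ge0}\frac{(-s)^p}{\Gamma(pa+1)}$, $s\ge0$, and for $r>0$ let $\mathcal E(r)$ denote the exponential distribution with parameter (rate) $r$, i.e. with mean $1/r$. (i) If $\alpha\in[-\tfrac12,0[$, then for all $x,y\in\mathbb N$, under $\mathbb P_x$, as $n\to\infty$, $N_n(y)/n^{|\alpha|}$ converges in law to $$\frac{(2y+2\alpha+1)\,\Gamma(y+2\alpha+1)\,\Gamma(|\alpha|)}{2^{\alpha+1}\,\Gamma(y+1)\,\Gamma(\alpha+1)}\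 \mathcal M(|\alpha|),$$ i.e. to the law of this constant times a random variable with distribution $\mathcal M(|\alpha|)$, where by convention $0\times\Gamma(0)=1$ (this concerns only $\alpha=-\tfrac12$, $y=0$). (ii) If $\alpha=0$, then for all $x,y\in\mathbb N$, under $\mathbb P_x$, as $n\to\infty$, $N_n(y)/\log n$ converges in law to $\mathcal E\!\left(\frac{2}{2y+1}\right)$. -/

import Mathlib

open MeasureTheory ProbabilityTheory Filter

noncomputable section

/-- Transition probabilities of the random walk on `ℕ` associated with the Gegenbauer polynomials
of index `α` and with step distribution `δ₁`: the birth and death chain with `p(0,1) = 1` and, for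
`i ≥ 1`, `p(i,i+1) = (i+2α+1)/(2i+2α+1)`, `p(i,i-1) = i/(2i+2α+1)`. -/
def gegenbauerTransition (α : ℝ) (i j : ℕ) : ℝ :=
  if i = 0 then (if j = 1 then 1 else 0)
  else if j = i + 1 then (i + 2 * α + 1) / (2 * i + 2 * α + 1)
  else if j + 1 = i then i / (2 * i + 2 * α + 1)
  else 0

/-- Under `P`, the process `S` is a homogeneous Markov chain on `ℕ` with transition probabilities
`p` that starts from `x`. The Markov property is written without conditional probabilities:
`P(S₀ = s₀, …, Sₙ₊₁ = sₙ₊₁) = P(S₀ = s₀, …, Sₙ = sₙ) p(sₙ, sₙ₊₁)`. -/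
structure IsMarkovChainFrom {Ω : Type*} [MeasurableSpace Ω] (p : ℕ → ℕ → ℝ) (x : ℕ)
    (P : Measure Ω) (S : ℕ → Ω → ℕ) : Prop where
  measurable : ∀ n, Measurable (S n)
  start : ∀ᵐ ω ∂P, S 0 ω = x
  markov : ∀ (n : ℕ) (s : ℕ → ℕ),
    P {ω | ∀ k ≤ n + 1, S k ω = s k}
      = P {ω | ∀ k ≤ n, S k ω = s k} * ENNReal.ofReal (p (s n) (s (n + 1)))

/-- The local time `Nₙ(y)`: the number of `k ∈ {0, …, n}` with `S_k = y`. -/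
def localTime {Ω : Type*} (S : ℕ → Ω → ℕ) (n y : ℕ) (ω : Ω) : ℕ :=
  ∑ k ∈ Finset.range (n + 1), if S k ω = y then 1 else 0

/-- `M` is a Mittag-Leffler distribution of parameter `a`: a probability distribution on `[0, ∞)`
with Laplace transform `s ↦ ∑ₚ (-s)ᵖ / Γ(p a + 1)`. -/
def IsMittagLeffler (a : ℝ) (M : ProbabilityMeasure ℝ) : Prop :=
  (∀ᵐ t ∂(M : Measure ℝ), 0 ≤ t) ∧
    ∀ s : ℝ, 0 ≤ s →
      HasSum (fun p : ℕ => (-s) ^ p / Real.Gamma (p * a + 1))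
        (∫ t, Real.exp (-s * t) ∂(M : Measure ℝ))

/-- `(2y+2α+1) Γ(y+2α+1)`, with the convention `0 × Γ(0) = 1`, which concerns `y = 0`,
`α = -1/2`. -/
def gegenbauerWeight (α : ℝ) (y : ℕ) : ℝ :=
  if 2 * (y : ℝ) + 2 * α + 1 = 0 then 1
  else (2 * y + 2 * α + 1) * Real.Gamma (y + 2 * α + 1)

/-- The scale `(2y+2α+1) Γ(y+2α+1) Γ(|α|) / (2^(α+1) Γ(y+1) Γ(α+1))` of the limit law. -/
def limitScale (α : ℝ) (y : ℕ) : ℝ :=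
  gegenbauerWeight α y * Real.Gamma |α| /
    ((2 : ℝ) ^ (α + 1) * Real.Gamma (y + 1) * Real.Gamma (α + 1))

instance isProbabilityMeasure_expMeasure_limit (y : ℕ) :
    IsProbabilityMeasure (expMeasure (2 / (2 * (y : ℝ) + 1))) :=
  isProbabilityMeasure_expMeasure (by positivity)

end

/-!
The chain is reversible and `p^(x + 2k)(x, 0)` has a closed form in Pochhammer symbols, so the Green
function `G_z(x, y) = ∑ₙ zⁿ pⁿ(x, y)` at `z = e^(-l/m)` is equivalent to an explicit constant times
`(m / l) ^ |α|` (to `log m` when `α = 0`). The generating function `∑ₙ zⁿ 𝔼ₓ[ρ ^ Nₙ(y)]` solves a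
resolvent equation and is a rational expression in Green functions; with `ρ = e^(-s / L m)` and `L`
the normalization of the local time, it converges after rescaling to the Laplace transform in `l` of
`t ↦ E_|α|(-c s t ^ |α|)` (of a constant when `α = 0`). Since `n ↦ 𝔼ₓ[ρ ^ Nₙ(y)]` is nonincreasing,
Karamata's Tauberian argument recovers the limit at the fixed time `t = 1`, which is a pointwise
limit of Laplace transforms of the normalized local times; the continuity theorem concludes, and
for `0 < |α| < 1` the same argument produces the Mittag-Leffler distribution.
-/

open scoped Topology ENNReal

section LaplaceTransform

theorem ext_of_forall_moment_eq {a b : ℝ} {μ ν : Measure ℝ} [IsProbabilityMeasure μ]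
    [IsProbabilityMeasure ν] (hμ : ∀ᵐ t ∂μ, t ∈ Set.Icc a b) (hν : ∀ᵐ t ∂ν, t ∈ Set.Icc a b)
    (h : ∀ n : ℕ, ∫ t, t ^ n ∂μ = ∫ t, t ^ n ∂ν) : μ = ν := by
  have integrable_of_continuous {κ : Measure ℝ} [IsProbabilityMeasure κ]
      (hκ : ∀ᵐ t ∂κ, t ∈ Set.Icc a b) {f : ℝ → ℝ} (hf : Continuous f) : Integrable f κ := by
    obtain ⟨C, hC⟩ :=
      isCompact_Icc.exists_bound_of_continuousOn (hf.continuousOn (s := Set.Icc a b))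
    exact .of_bound hf.aestronglyMeasurable C (hκ.mono hC)
  have integral_eval_eq (p : Polynomial ℝ) : ∫ t, p.eval t ∂μ = ∫ t, p.eval t ∂ν := by
    simp only [Polynomial.eval_eq_sum, Polynomial.sum]
    rw [integral_finsetSum _ fun i _ => integrable_of_continuous hμ (by fun_prop),
      integral_finsetSum _ fun i _ => integrable_of_continuous hν (by fun_prop)]
    simp only [integral_const_mul, h]
  have abs_integral_sub_le {κ : Measure ℝ} [IsProbabilityMeasure κ]
      (hκ : ∀ᵐ t ∂κ, t ∈ Set.Icc a b) (f : BoundedContinuousFunction ℝ ℝ) (p : Polynomial ℝ)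
      {ε : ℝ} (hp : ∀ t ∈ Set.Icc a b, |p.eval t - f t| < ε) :
      |∫ t, p.eval t ∂κ - ∫ t, f t ∂κ| ≤ ε := by
    rw [← integral_sub (integrable_of_continuous hκ p.continuous)
      (integrable_of_continuous hκ f.continuous)]
    simpa using norm_integral_le_of_norm_le_const (f := fun t => p.eval t - f t) (C := ε)
      (hκ.mono fun t ht => (hp t ht).le)
  refine ext_of_forall_integral_eq_of_IsFiniteMeasure fun f => ?_
  refine eq_of_forall_dist_le fun ε hε => ?_
  obtain ⟨p, hp⟩ := exists_polynomial_near_of_continuousOn a b f f.continuous.continuousOn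
    (ε / 2) (half_pos hε)
  have hpμ := abs_integral_sub_le hμ f p hp
  have hpν := abs_integral_sub_le hν f p hp
  rw [integral_eval_eq p] at hpμ
  rw [Real.dist_eq]
  grind

theorem ext_of_forall_laplace_nat_eq {μ ν : Measure ℝ} [IsProbabilityMeasure μ]
    [IsProbabilityMeasure ν] (hμ : ∀ᵐ t ∂μ, 0 ≤ t) (hν : ∀ᵐ t ∂ν, 0 ≤ t)
    (h : ∀ n : ℕ, ∫ t, Real.exp (-(n : ℝ) * t) ∂μ = ∫ t, Real.exp (-(n : ℝ) * t) ∂ν) :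
    μ = ν := by
  have hmeas : Measurable fun t : ℝ => Real.exp (-t) := by fun_prop
  have map_log_map_exp (κ : Measure ℝ) :
      (κ.map fun t => Real.exp (-t)).map (fun u => -Real.log u) = κ := by
    rw [Measure.map_map (by fun_prop) hmeas]
    simp [Function.comp_def]
  have support_map_exp {κ : Measure ℝ} (hκ : ∀ᵐ t ∂κ, 0 ≤ t) :
      ∀ᵐ u ∂κ.map fun t => Real.exp (-t), u ∈ Set.Icc (0 : ℝ) 1 := by
    refine (ae_map_iff hmeas.aemeasurable measurableSet_Icc).2 ?_
    filter_upwards [hκ] with t ht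
    exact ⟨(Real.exp_pos _).le, Real.exp_le_one_iff.2 (neg_nonpos.2 ht)⟩
  have moment_map_exp (κ : Measure ℝ) (n : ℕ) :
      ∫ u, u ^ n ∂κ.map (fun t => Real.exp (-t)) = ∫ t, Real.exp (-(n : ℝ) * t) ∂κ := by
    rw [integral_map hmeas.aemeasurable (by fun_prop)]
    simp only [← Real.exp_nat_mul, mul_neg, neg_mul]
  have := Measure.isProbabilityMeasure_map (μ := μ) hmeas.aemeasurable
  have := Measure.isProbabilityMeasure_map (μ := ν) hmeas.aemeasurable
  rw [← map_log_map_exp μ, ← map_log_map_exp ν,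
    ext_of_forall_moment_eq (support_map_exp hμ) (support_map_exp hν)
      fun n => by rw [moment_map_exp, moment_map_exp, h]]

theorem integrable_exp_neg_mul {μ : Measure ℝ} [IsFiniteMeasure μ] (hμ : ∀ᵐ t ∂μ, 0 ≤ t)
    {s : ℝ} (hs : 0 ≤ s) : Integrable (fun t => Real.exp (-s * t)) μ := by
  refine Integrable.of_bound (by fun_prop) 1 ?_
  filter_upwards [hμ] with t ht
  simpa using mul_nonneg hs ht

theorem measureReal_norm_gt_le_laplace {μ : Measure ℝ} [IsProbabilityMeasure μ]
    (hμ : ∀ᵐ t ∂μ, 0 ≤ t) {s r : ℝ} (hs : 0 ≤ s) (hr : 1 ≤ s * r) :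
    μ.real {x | r < ‖x‖} ≤ 2 * (1 - ∫ t, Real.exp (-s * t) ∂μ) := by
  have hint := (integrable_const (1 : ℝ)).sub (integrable_exp_neg_mul hμ hs)
  have markov := mul_meas_ge_le_integral_of_nonneg (μ := μ) (f := fun t => 1 - Real.exp (-s * t))
    (hμ.mono fun t ht => by simpa using mul_nonneg hs ht) hint (1 / 2)
  have hsubset : μ.real {x | r < ‖x‖} ≤ μ.real {t | 1 / 2 ≤ 1 - Real.exp (-s * t)} := by
    refine ENNReal.toReal_mono (measure_ne_top _ _) (measure_mono_ae ?_)
    filter_upwards [hμ] with t ht (hrt : r < ‖t‖)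
    have hrt : r < t := by rwa [Real.norm_of_nonneg ht] at hrt
    have hexp : Real.exp (-s * t) ≤ Real.exp (-1) := Real.exp_le_exp.2 (by nlinarith)
    have := Real.exp_neg_one_lt_d9
    change 1 / 2 ≤ 1 - Real.exp (-s * t)
    linarith
  rw [integral_sub (integrable_const _) (integrable_exp_neg_mul hμ hs)] at markov
  simp only [integral_const, probReal_univ, smul_eq_mul, one_mul] at markov
  linarith

theorem isTightMeasureSet_range_of_laplace_tendsto {μ : ℕ → ProbabilityMeasure ℝ} {φ : ℝ → ℝ}
    (hμ : ∀ n, ∀ᵐ t ∂(μ n : Measure ℝ), 0 ≤ t)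
    (hφ : ∀ s, 0 < s →
      Tendsto (fun n => ∫ t, Real.exp (-s * t) ∂(μ n : Measure ℝ)) atTop (𝓝 (φ s)))
    (hφ0 : Tendsto φ (𝓝[>] 0) (𝓝 1)) :
    IsTightMeasureSet (Set.range fun n => (μ n : Measure ℝ)) := by
  apply isTightMeasureSet_range_of_tendsto_limsup_measure_norm_gt
  refine ENNReal.tendsto_nhds_zero.2 fun ε hε => ?_
  obtain ⟨δ, -, hδ⟩ := ENNReal.lt_iff_exists_real_btwn.1 hε
  have hδ0 : 0 < δ := ENNReal.ofReal_pos.1 hδ.1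
  obtain ⟨s, hs, hs0 : 0 < s⟩ := ((hφ0.eventually_const_lt
    (show 1 - δ / 2 < 1 by linarith)).and self_mem_nhdsWithin).exists
  filter_upwards [eventually_ge_atTop (1 / s)] with r hr
  have hr : 1 ≤ s * r := by rwa [div_le_iff₀' hs0] at hr
  refine limsup_le_of_le (by isBoundedDefault) ?_
  filter_upwards [(hφ s hs0).eventually_const_lt hs] with n hn
  refine le_trans ?_ hδ.2.le
  rw [← ofReal_measureReal]
  exact ENNReal.ofReal_le_ofReal (by linarith [measureReal_norm_gt_le_laplace (hμ n) hs0.le hr])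

theorem ae_nonneg_of_tendsto {ι : Type*} {F : Filter ι} [F.NeBot] {μ : ι → ProbabilityMeasure ℝ}
    {ν : ProbabilityMeasure ℝ} (hμ : ∀ n, ∀ᵐ t ∂(μ n : Measure ℝ), 0 ≤ t)
    (hν : Tendsto μ F (𝓝 ν)) : ∀ᵐ t ∂(ν : Measure ℝ), 0 ≤ t := by
  simp only [ae_iff, not_le] at hμ ⊢
  have := ProbabilityMeasure.le_liminf_measure_open_of_tendsto hν (isOpen_Iio (a := (0 : ℝ)))
  simpa [Set.Iio, hμ] using this

theorem tendsto_laplace_of_tendsto {ι : Type*} {F : Filter ι} [F.NeBot]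
    {μ : ι → ProbabilityMeasure ℝ} {ν : ProbabilityMeasure ℝ}
    (hμ : ∀ n, ∀ᵐ t ∂(μ n : Measure ℝ), 0 ≤ t) (hν : Tendsto μ F (𝓝 ν)) {s : ℝ} (hs : 0 ≤ s) :
    Tendsto (fun n => ∫ t, Real.exp (-s * t) ∂(μ n : Measure ℝ)) F
      (𝓝 (∫ t, Real.exp (-s * t) ∂(ν : Measure ℝ))) := by
  let f : BoundedContinuousFunction ℝ ℝ := .ofNormedAddCommGroup
    (fun t => Real.exp (-s * max t 0)) (by fun_prop) 1
    fun t => by simpa using mul_nonneg hs (le_max_right t 0)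
  have integral_f {κ : Measure ℝ} (hκ : ∀ᵐ t ∂κ, 0 ≤ t) :
      ∫ t, f t ∂κ = ∫ t, Real.exp (-s * t) ∂κ :=
    integral_congr_ae (hκ.mono fun t ht => by simp [f, max_eq_left ht])
  simpa only [integral_f (hμ _), integral_f (ae_nonneg_of_tendsto hμ hν)] using
    ProbabilityMeasure.tendsto_iff_forall_integral_tendsto.1 hν f

theorem exists_tendsto_of_laplace_tendsto {μ : ℕ → ProbabilityMeasure ℝ} {φ : ℝ → ℝ}
    (hμ : ∀ n, ∀ᵐ t ∂(μ n : Measure ℝ), 0 ≤ t)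
    (hφ : ∀ s, 0 < s →
      Tendsto (fun n => ∫ t, Real.exp (-s * t) ∂(μ n : Measure ℝ)) atTop (𝓝 (φ s)))
    (hφ0 : Tendsto φ (𝓝[>] 0) (𝓝 1)) :
    ∃ ν : ProbabilityMeasure ℝ, (∀ᵐ t ∂(ν : Measure ℝ), 0 ≤ t) ∧
      (∀ s, 0 < s → ∫ t, Real.exp (-s * t) ∂(ν : Measure ℝ) = φ s) ∧
      Tendsto μ atTop (𝓝 ν) := by
  have hcompact : IsCompact (closure (Set.range μ)) := by
    apply isCompact_closure_of_isTightMeasureSet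
    convert isTightMeasureSet_range_of_laplace_tendsto hμ hφ hφ0 using 1
    ext
    simp
  have hmem : ∀ᶠ n in atTop, μ n ∈ closure (Set.range μ) :=
    .of_forall fun n => subset_closure ⟨n, rfl⟩
  have cluster {ν : ProbabilityMeasure ℝ} (hν : MapClusterPt ν atTop μ) :
      (∀ᵐ t ∂(ν : Measure ℝ), 0 ≤ t) ∧
        ∀ s, 0 < s → ∫ t, Real.exp (-s * t) ∂(ν : Measure ℝ) = φ s := by
    obtain ⟨U, hU, hUν⟩ := mapClusterPt_iff_ultrafilter.1 hν
    exact ⟨ae_nonneg_of_tendsto hμ hUν, fun s hs =>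
      tendsto_nhds_unique (tendsto_laplace_of_tendsto hμ hUν hs.le) ((hφ s hs).mono_left hU)⟩
  obtain ⟨ν, -, hν⟩ := hcompact.exists_mapClusterPt (tendsto_principal.2 hmem)
  refine ⟨ν, (cluster hν).1, (cluster hν).2,
    hcompact.tendsto_nhds_of_unique_mapClusterPt hmem fun ν' _ hν' => ?_⟩
  refine ProbabilityMeasure.toMeasure_injective ?_
  refine ext_of_forall_laplace_nat_eq (cluster hν').1 (cluster hν).1 fun n => ?_
  rcases n.eq_zero_or_pos with rfl | hn
  · simp
  · rw [(cluster hν').2 n (by positivity), (cluster hν).2 n (by positivity)]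

end LaplaceTransform

section Tauberian

/-- The Abel mean `m⁻¹ ∑ₙ e^(-l n / m) f n`: a Riemann sum with mesh `1 / m` for the Laplace
integral at `l` of `t ↦ f (m t)`. -/
noncomputable def abelMean (l : ℝ) (f : ℕ → ℝ) (m : ℕ) : ℝ :=
  (m : ℝ)⁻¹ * ∑' n : ℕ, Real.exp (-(l * (n / m))) * f n

/-- The rescaled Abel means at rate `l` of the bounded sequences `f m` converge to the Laplace
integral `∫₀^∞ e^(-l t) φ t dt`, as they do when `f m n ≈ φ (n / m)`. -/
structure HasAbelLimit (l : ℝ) (f : ℕ → ℕ → ℝ) (φ : ℝ → ℝ) : Prop where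
  bounded : ∃ C, ∀ m n, |f m n| ≤ C
  integrableOn : IntegrableOn (fun t => Real.exp (-(l * t)) * φ t) (Set.Ioi 0)
  tendsto : Tendsto (fun m => abelMean l (f m) m) atTop
    (𝓝 (∫ t in Set.Ioi 0, Real.exp (-(l * t)) * φ t))

theorem exp_neg_mul_natCast_div (l : ℝ) (m n : ℕ) :
    Real.exp (-(l * (n / m))) = Real.exp (-(l / m)) ^ n := by
  rw [← Real.exp_nat_mul]
  ring_nf

theorem exp_neg_div_natCast_mem_Ico {l : ℝ} (hl : 0 < l) {m : ℕ} (hm : 0 < m) :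
    Real.exp (-(l / m)) ∈ Set.Ico (0 : ℝ) 1 :=
  ⟨(Real.exp_pos _).le, Real.exp_lt_one_iff.2 (neg_lt_zero.2 (by positivity))⟩

theorem exp_neg_div_natCast_sq (l : ℝ) (m : ℕ) :
    Real.exp (-(l / m)) ^ 2 = Real.exp (-(2 * l / m)) := by
  rw [← Real.exp_nat_mul]
  congr 1
  ring

theorem tendsto_exp_neg_div_natCast {l : ℝ} (hl : 0 < l) :
    Tendsto (fun m : ℕ => Real.exp (-(l / m))) atTop (𝓝[<] 1) := by
  refine tendsto_nhdsWithin_iff.2 ⟨?_, ?_⟩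
  · simpa using (tendsto_const_div_atTop_nhds_zero_nat l).neg.rexp
  · filter_upwards [eventually_gt_atTop 0] with m hm
    exact (exp_neg_div_natCast_mem_Ico hl hm).2

theorem summable_exp_neg_mul_of_bounded {l : ℝ} (hl : 0 < l) {m : ℕ} (hm : 0 < m) {f : ℕ → ℝ}
    {C : ℝ} (hf : ∀ n, |f n| ≤ C) : Summable fun n : ℕ => Real.exp (-(l * (n / m))) * f n := by
  have hgeom : Summable fun n : ℕ => Real.exp (-(l / m)) ^ n :=
    summable_geometric_of_lt_one (Real.exp_pos _).le (exp_neg_div_natCast_mem_Ico hl hm).2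
  refine .of_norm_bounded (hgeom.mul_right C) fun n => ?_
  rw [norm_mul, exp_neg_mul_natCast_div, Real.norm_of_nonneg (by positivity)]
  exact mul_le_mul_of_nonneg_left (hf n) (by positivity)

theorem abelMean_one {l : ℝ} (hl : 0 < l) {m : ℕ} (hm : 0 < m) :
    abelMean l (fun _ => 1) m = (m * (1 - Real.exp (-(l / m))))⁻¹ := by
  simp only [abelMean, mul_one, exp_neg_mul_natCast_div]
  rw [tsum_geometric_of_lt_one (Real.exp_pos _).le (exp_neg_div_natCast_mem_Ico hl hm).2, mul_inv]

theorem abs_abelMean_le {l : ℝ} (hl : 0 < l) {m : ℕ} (hm : 0 < m) {f : ℕ → ℝ} {C : ℝ}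
    (hf : ∀ n, |f n| ≤ C) : |abelMean l f m| ≤ C * abelMean l (fun _ => 1) m := by
  have hsum := summable_exp_neg_mul_of_bounded hl hm (f := fun _ => 1) (C := 1) (by simp)
  rw [abelMean, abelMean, abs_mul, abs_of_nonneg (by positivity : 0 ≤ (m : ℝ)⁻¹),
    mul_left_comm, ← tsum_mul_left]
  refine mul_le_mul_of_nonneg_left ?_ (by positivity)
  rw [← Real.norm_eq_abs]
  refine tsum_of_norm_bounded (hsum.mul_left C).hasSum fun n => ?_
  rw [norm_mul, Real.norm_of_nonneg (Real.exp_pos _).le, mul_one, mul_comm]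
  exact mul_le_mul_of_nonneg_right (hf n) (Real.exp_pos _).le

theorem abelMean_add {l : ℝ} (hl : 0 < l) {m : ℕ} (hm : 0 < m) {f g : ℕ → ℝ} {C D : ℝ}
    (hf : ∀ n, |f n| ≤ C) (hg : ∀ n, |g n| ≤ D) :
    abelMean l (fun n => f n + g n) m = abelMean l f m + abelMean l g m := by
  simp only [abelMean, mul_add]
  rw [(summable_exp_neg_mul_of_bounded hl hm hf).tsum_add
    (summable_exp_neg_mul_of_bounded hl hm hg), mul_add]

theorem abelMean_const_mul (l c : ℝ) (f : ℕ → ℝ) (m : ℕ) :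
    abelMean l (fun n => c * f n) m = c * abelMean l f m := by
  simp only [abelMean, mul_left_comm _ c, tsum_mul_left]

theorem abelMean_sub {l : ℝ} (hl : 0 < l) {m : ℕ} (hm : 0 < m) {f g : ℕ → ℝ} {C D : ℝ}
    (hf : ∀ n, |f n| ≤ C) (hg : ∀ n, |g n| ≤ D) :
    abelMean l (fun n => f n - g n) m = abelMean l f m - abelMean l g m := by
  have := abelMean_add hl hm hf (g := fun n => -1 * g n) (D := D) (by simpa using hg)
  rw [abelMean_const_mul] at this
  simpa only [neg_one_mul, ← sub_eq_add_neg] using this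

theorem tendsto_mul_one_sub_exp_neg_div (l : ℝ) {ι : Type*} {F : Filter ι} {L : ι → ℝ}
    (hL : Tendsto L F atTop) :
    Tendsto (fun i => L i * (1 - Real.exp (-(l / L i)))) F (𝓝 l) := by
  have hderiv : HasDerivAt (fun x : ℝ => 1 - Real.exp (-(l * x))) l 0 := by
    simpa using (((hasDerivAt_id (0 : ℝ)).const_mul l).neg.exp).const_sub 1
  refine (hderiv.tendsto_slope_zero_right.comp (tendsto_inv_atTop_nhdsGT_zero.comp hL)).congr
    fun i => ?_
  simp [div_eq_mul_inv]

theorem integral_exp_neg_mul {l : ℝ} (hl : 0 < l) :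
    ∫ t in Set.Ioi 0, Real.exp (-(l * t)) = l⁻¹ := by
  simpa [div_eq_mul_inv] using integral_exp_mul_Ioi (neg_lt_zero.2 hl) 0

theorem hasAbelLimit_const {l : ℝ} (hl : 0 < l) (c : ℝ) :
    HasAbelLimit l (fun _ _ => c) fun _ => c := by
  have hint := integrableOn_exp_mul_Ioi (neg_lt_zero.2 hl) 0
  simp only [neg_mul] at hint
  refine ⟨⟨|c|, fun _ _ => le_rfl⟩, hint.mul_const c, ?_⟩
  have hlim := (tendsto_mul_one_sub_exp_neg_div l
    (tendsto_natCast_atTop_atTop (R := ℝ))).inv₀ hl.ne'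
  rw [integral_mul_const, integral_exp_neg_mul hl]
  refine (hlim.mul_const c).congr' ?_
  filter_upwards [eventually_gt_atTop 0] with m hm
  rw [← abelMean_one hl hm, mul_comm, ← abelMean_const_mul]
  simp only [mul_one]

namespace HasAbelLimit

variable {l : ℝ} {f g : ℕ → ℕ → ℝ} {φ ψ : ℝ → ℝ}

theorem add (hl : 0 < l) (hf : HasAbelLimit l f φ) (hg : HasAbelLimit l g ψ) :
    HasAbelLimit l (fun m n => f m n + g m n) fun t => φ t + ψ t := by
  obtain ⟨C, hC⟩ := hf.bounded
  obtain ⟨D, hD⟩ := hg.bounded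
  refine ⟨⟨C + D, fun m n => (abs_add_le _ _).trans (add_le_add (hC m n) (hD m n))⟩, ?_, ?_⟩
  · simp only [mul_add]
    exact hf.integrableOn.add hg.integrableOn
  · simp only [mul_add]
    rw [integral_add hf.integrableOn hg.integrableOn]
    refine (hf.tendsto.add hg.tendsto).congr' ?_
    filter_upwards [eventually_gt_atTop 0] with m hm
    exact (abelMean_add hl hm (hC m) (hD m)).symm

theorem const_mul (c : ℝ) (hf : HasAbelLimit l f φ) :
    HasAbelLimit l (fun m n => c * f m n) fun t => c * φ t := by
  obtain ⟨C, hC⟩ := hf.bounded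
  refine ⟨⟨|c| * C, fun m n => ?_⟩, ?_, ?_⟩
  · rw [abs_mul]
    exact mul_le_mul_of_nonneg_left (hC m n) (abs_nonneg c)
  · simp only [mul_left_comm _ c]
    exact hf.integrableOn.const_mul c
  · simpa only [abelMean_const_mul, mul_left_comm _ c, integral_const_mul]
      using hf.tendsto.const_mul c

theorem sub (hl : 0 < l) (hf : HasAbelLimit l f φ) (hg : HasAbelLimit l g ψ) :
    HasAbelLimit l (fun m n => f m n - g m n) fun t => φ t - ψ t := by
  simpa only [neg_one_mul, ← sub_eq_add_neg] using hf.add hl (hg.const_mul (-1))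

theorem exp_pow_mul (k : ℕ) (hf : HasAbelLimit (l + k) f φ) :
    HasAbelLimit l (fun m n => Real.exp (-(n / m)) ^ k * f m n)
      fun t => Real.exp (-t) ^ k * φ t := by
  have exp_shift (t : ℝ) :
      Real.exp (-(l * t)) * Real.exp (-t) ^ k = Real.exp (-((l + k) * t)) := by
    rw [← Real.exp_nat_mul, ← Real.exp_add]
    ring_nf
  obtain ⟨C, hC⟩ := hf.bounded
  refine ⟨⟨C, fun m n => ?_⟩, ?_, ?_⟩
  · rw [abs_mul, abs_of_nonneg (by positivity)]
    have hexp : Real.exp (-((n : ℝ) / m)) ≤ 1 := by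
      simpa using (by positivity : (0 : ℝ) ≤ n / m)
    exact (mul_le_of_le_one_left (abs_nonneg _) (pow_le_one₀ (Real.exp_pos _).le hexp)).trans
      (hC m n)
  · simpa only [← mul_assoc, exp_shift] using hf.integrableOn
  · simpa only [abelMean, ← mul_assoc, exp_shift] using hf.tendsto

theorem polynomial_mul (hl : 0 < l) (hf : ∀ k : ℕ, HasAbelLimit (l + k) f φ)
    (p : Polynomial ℝ) :
    HasAbelLimit l (fun m n => p.eval (Real.exp (-(n / m))) * f m n)
      fun t => p.eval (Real.exp (-t)) * φ t := by
  induction p using Polynomial.induction_on' with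
  | add p q hp hq => simpa only [Polynomial.eval_add, add_mul] using hp.add hl hq
  | monomial k c =>
    simpa only [Polynomial.eval_monomial, mul_assoc] using ((hf k).exp_pow_mul k).const_mul c

end HasAbelLimit

theorem exp_neg_mem_Icc {t : ℝ} (ht : 0 ≤ t) : Real.exp (-t) ∈ Set.Icc (0 : ℝ) 1 :=
  ⟨(Real.exp_pos _).le, Real.exp_le_one_iff.2 (neg_nonpos.2 ht)⟩

theorem HasAbelLimit.of_forall_approx {l : ℝ} {f : ℕ → ℕ → ℝ} {φ φ₀ : ℝ → ℝ} {C : ℝ}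
    (hl : 0 < l) {B : ℝ} (hf : ∀ m n, |f m n| ≤ B)
    (hφ : IntegrableOn (fun t => Real.exp (-(l * t)) * φ t) (Set.Ioi 0))
    (hφ₀ : IntegrableOn (fun t => Real.exp (-(l * t)) * φ₀ t) (Set.Ioi 0))
    (happrox : ∀ ε > 0, ∃ g ψ, HasAbelLimit l g ψ ∧ (∀ m n, |f m n - g m n| ≤ ε * C) ∧
      ∀ t, 0 < t → |φ t - ψ t| ≤ ε * |φ₀ t|) : HasAbelLimit l f φ := by
  refine ⟨⟨B, hf⟩, hφ, Metric.tendsto_nhds.2 fun δ hδ => ?_⟩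
  set D := ∫ t in Set.Ioi 0, |Real.exp (-(l * t)) * φ₀ t|
  obtain ⟨ε, hε, hεC, hεD⟩ : ∃ ε > 0, ε * (C * (l⁻¹ + 1)) < δ / 3 ∧ ε * D < δ / 3 := by
    have small (K : ℝ) : ∀ᶠ ε in 𝓝[>] (0 : ℝ), ε * K < δ / 3 := by
      refine Tendsto.eventually_lt_const (v := 0 * K) (by linarith) ?_
      exact (tendsto_id.mono_left nhdsWithin_le_nhds).mul_const K
    obtain ⟨ε, hε, h⟩ := (((small _).and (small _)).and self_mem_nhdsWithin).exists
    exact ⟨ε, h, hε⟩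
  obtain ⟨g, ψ, hg, hfg, hφψ⟩ := happrox ε hε
  obtain ⟨B', hB'⟩ := hg.bounded
  have hC : 0 ≤ ε * C := (abs_nonneg _).trans (hfg 0 0)
  have hI : |(∫ t in Set.Ioi 0, Real.exp (-(l * t)) * φ t) -
      ∫ t in Set.Ioi 0, Real.exp (-(l * t)) * ψ t| ≤ ε * D := by
    rw [← integral_sub hφ hg.integrableOn, ← integral_const_mul, ← Real.norm_eq_abs]
    refine norm_integral_le_of_norm_le (hφ₀.abs.const_mul _) ?_
    filter_upwards [ae_restrict_mem measurableSet_Ioi] with t ht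
    rw [← mul_sub, norm_mul, abs_mul, abs_of_pos (Real.exp_pos _),
      Real.norm_of_nonneg (Real.exp_pos _).le, mul_left_comm]
    exact mul_le_mul_of_nonneg_left (hφψ t ht) (Real.exp_pos _).le
  have hsum : ∀ᶠ m in atTop, abelMean l (fun _ => 1) m < l⁻¹ + 1 := by
    refine Tendsto.eventually_lt_const (lt_add_one _) ?_
    simpa [integral_exp_neg_mul hl] using (hasAbelLimit_const hl 1).tendsto
  filter_upwards [eventually_gt_atTop 0, hsum,
    Metric.tendsto_nhds.1 hg.tendsto (δ / 3) (by positivity)] with m hm hm1 hgm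
  have hS := (abs_abelMean_le hl hm (hfg m)).trans (mul_le_mul_of_nonneg_left hm1.le hC)
  rw [abelMean_sub hl hm (hf m) (hB' m)] at hS
  rw [Real.dist_eq] at hgm ⊢
  grind

/-- Karamata's device: by Weierstrass' theorem, convergence of the Abel means at the rates `l + k`
allows inserting any continuous function of `e^(-t)`. -/
theorem HasAbelLimit.continuous_mul {l : ℝ} {f : ℕ → ℕ → ℝ} {φ : ℝ → ℝ} (hl : 0 < l)
    (hf : ∀ k : ℕ, HasAbelLimit (l + k) f φ) {g : ℝ → ℝ} (hg : Continuous g) :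
    HasAbelLimit l (fun m n => g (Real.exp (-(n / m))) * f m n)
      fun t => g (Real.exp (-t)) * φ t := by
  have hf0 : HasAbelLimit l f φ := by simpa using hf 0
  obtain ⟨C, hC⟩ := hf0.bounded
  obtain ⟨B, hB⟩ :=
    isCompact_Icc.exists_bound_of_continuousOn (hg.continuousOn (s := Set.Icc 0 1))
  have hmem (m n : ℕ) : Real.exp (-(n / m)) ∈ Set.Icc (0 : ℝ) 1 :=
    exp_neg_mem_Icc (by positivity)
  refine .of_forall_approx (B := B * C) (C := C) hl (fun m n => ?_) ?_ hf0.integrableOn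
    fun ε hε => ?_
  · rw [abs_mul]
    exact mul_le_mul (hB _ (hmem m n)) (hC m n) (abs_nonneg _)
      ((norm_nonneg _).trans (hB _ (hmem m n)))
  · simp only [mul_left_comm _ (g _)]
    refine Integrable.bdd_mul (c := B) hf0.integrableOn (by fun_prop) ?_
    filter_upwards [ae_restrict_mem measurableSet_Ioi] with t ht
    exact hB _ (exp_neg_mem_Icc ht.le)
  · obtain ⟨p, hp⟩ := exists_polynomial_near_of_continuousOn 0 1 g hg.continuousOn ε hε
    refine ⟨_, _, HasAbelLimit.polynomial_mul hl hf p, fun m n => ?_, fun t ht => ?_⟩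
    · rw [← sub_mul, abs_mul, abs_sub_comm]
      exact mul_le_mul (hp _ (hmem m n)).le (hC m n) (abs_nonneg _) hε.le
    · rw [← sub_mul, abs_mul, abs_sub_comm]
      exact mul_le_mul_of_nonneg_right (hp _ (exp_neg_mem_Icc ht.le)).le (abs_nonneg _)

theorem HasAbelLimit.eventually_exists_pos {l : ℝ} {f : ℕ → ℕ → ℝ} {φ : ℝ → ℝ} (hl : 0 < l)
    (hf : ∀ k : ℕ, HasAbelLimit (l + k) f φ) {t₁ t₂ : ℝ} (ht₁ : 0 ≤ t₁) (ht : t₁ < t₂)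
    (hφ : ∀ t ∈ Set.Ioo t₁ t₂, 0 < φ t) :
    ∀ᶠ m : ℕ in atTop, ∃ n : ℕ, (n / m : ℝ) ∈ Set.Ioo t₁ t₂ ∧ 0 < f m n := by
  set g : ℝ → ℝ := fun u => Metric.infDist u (Set.Ioo (Real.exp (-t₂)) (Real.exp (-t₁)))ᶜ
  have hg0 (u : ℝ) : 0 ≤ g u := Metric.infDist_nonneg
  have hg_pos (t : ℝ) : 0 < g (Real.exp (-t)) ↔ t ∈ Set.Ioo t₁ t₂ := by
    rw [← isOpen_Ioo.isClosed_compl.notMem_iff_infDist_pos ⟨Real.exp (-t₁), by simp⟩,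
      Set.notMem_compl_iff]
    simp [and_comm]
  have hgf := HasAbelLimit.continuous_mul hl hf (g := g) (Metric.continuous_infDist_pt _)
  have hI : 0 < ∫ t in Set.Ioi 0, Real.exp (-(l * t)) * (g (Real.exp (-t)) * φ t) := by
    have hnonneg (t : ℝ) : 0 ≤ Real.exp (-(l * t)) * (g (Real.exp (-t)) * φ t) := by
      refine mul_nonneg (Real.exp_pos _).le ?_
      rcases (hg0 (Real.exp (-t))).eq_or_lt with h | h
      · simp [← h]
      · exact mul_nonneg h.le (hφ t ((hg_pos t).1 h)).le
    rw [setIntegral_pos_iff_support_of_nonneg_ae (ae_of_all _ hnonneg) hgf.integrableOn]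
    refine lt_of_lt_of_le ?_ (measure_mono (s := Set.Ioo t₁ t₂) fun t htt => ⟨?_, ?_⟩)
    · simp [ht]
    · have := mul_pos ((hg_pos t).2 htt) (hφ t htt)
      exact (mul_pos (Real.exp_pos _) this).ne'
    · exact ht₁.trans_lt htt.1
  filter_upwards [hgf.tendsto.eventually_const_lt hI] with m hm
  by_contra! hcon
  refine hm.not_ge (mul_nonpos_of_nonneg_of_nonpos (by positivity) (tsum_nonpos fun n => ?_))
  refine mul_nonpos_of_nonneg_of_nonpos (Real.exp_pos _).le ?_
  rcases (hg0 (Real.exp (-(n / m)))).eq_or_lt with h | h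
  · simp [← h]
  · exact mul_nonpos_of_nonneg_of_nonpos h.le (hcon n ((hg_pos _).1 h))

theorem tendsto_diag_of_hasAbelLimit {h : ℕ → ℕ → ℝ} {ψ : ℝ → ℝ} {l : ℝ} (hl : 0 < l)
    (hanti : ∀ m, Antitone (h m)) (hh : ∀ k : ℕ, HasAbelLimit (l + k) h ψ)
    (hψ : ContinuousAt ψ 1) : Tendsto (fun m => h m m) atTop (𝓝 (ψ 1)) := by
  have hlk (k : ℕ) : 0 < l + k := by positivity
  refine tendsto_order.2 ⟨fun A hA => ?_, fun B hB => ?_⟩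
  · obtain ⟨a, b, hab, hsub⟩ := mem_nhds_iff_exists_Ioo_subset.1 (hψ.eventually_const_lt hA)
    have hpos := HasAbelLimit.eventually_exists_pos hl
      (fun k => (hh k).sub (hlk k) (hasAbelLimit_const (hlk k) A)) zero_le_one hab.2
      fun t ht => sub_pos.2 (hsub ⟨hab.1.trans ht.1, ht.2⟩)
    filter_upwards [hpos, eventually_gt_atTop 0] with m ⟨n, hn, hAn⟩ hm
    have hmn : m ≤ n := by exact_mod_cast ((one_lt_div (by positivity : (0 : ℝ) < m)).1 hn.1).le
    exact (sub_pos.1 hAn).trans_le (hanti m hmn)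
  · obtain ⟨a, b, hab, hsub⟩ := mem_nhds_iff_exists_Ioo_subset.1 (hψ.eventually_lt_const hB)
    have hpos := HasAbelLimit.eventually_exists_pos hl
      (fun k => (hasAbelLimit_const (hlk k) B).sub (hlk k) (hh k)) (le_max_right a 0)
      (max_lt hab.1 one_pos)
      fun t ht => sub_pos.2 (hsub ⟨(le_max_left a 0).trans_lt ht.1, ht.2.trans hab.2⟩)
    filter_upwards [hpos, eventually_gt_atTop 0] with m ⟨n, hn, hBn⟩ hm
    have hnm : n ≤ m := by exact_mod_cast ((div_lt_one (by positivity : (0 : ℝ) < m)).1 hn.2).le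
    exact (hanti m hnm).trans_lt (sub_pos.1 hBn)

end Tauberian

section MittagLeffler

/-- The Mittag-Leffler function `E_a`. -/
noncomputable def mittagLeffler (a x : ℝ) : ℝ := ∑' p : ℕ, x ^ p / Real.Gamma (p * a + 1)

theorem rpow_mul_exp_neg_le_Gamma {x T : ℝ} (hx : 0 ≤ x) (hT : 0 < T) :
    T ^ x * Real.exp (-T) ≤ Real.Gamma (x + 1) := by
  have hi := Real.GammaIntegral_convergent (s := x + 1) (by linarith)
  have hsub : Set.Ioi T ⊆ Set.Ioi 0 := Set.Ioi_subset_Ioi hT.le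
  calc T ^ x * Real.exp (-T) = ∫ t in Set.Ioi T, T ^ x * Real.exp (-t) := by
        rw [integral_const_mul, integral_exp_neg_Ioi]
    _ ≤ ∫ t in Set.Ioi T, Real.exp (-t) * t ^ (x + 1 - 1) := by
        refine setIntegral_mono_on ((integrableOn_exp_neg_Ioi T).const_mul _) (hi.mono_set hsub)
          measurableSet_Ioi fun t ht => ?_
        rw [mul_comm, add_sub_cancel_right]
        exact mul_le_mul_of_nonneg_left (Real.rpow_le_rpow hT.le (le_of_lt ht) hx)
          (Real.exp_pos _).le
    _ ≤ ∫ t in Set.Ioi 0, Real.exp (-t) * t ^ (x + 1 - 1) := by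
        refine setIntegral_mono_set hi ?_ hsub.eventuallyLE
        filter_upwards [ae_restrict_mem measurableSet_Ioi] with t (ht : 0 < t)
        positivity
    _ = Real.Gamma (x + 1) := (Real.Gamma_eq_integral (by linarith)).symm

theorem norm_mittagLeffler_term_le {a : ℝ} (ha : 0 < a) {R x : ℝ} (hR : 0 < R) (hx : |x| ≤ R)
    (p : ℕ) : ‖x ^ p / Real.Gamma (p * a + 1)‖ ≤ Real.exp ((2 * R) ^ (1 / a)) * (1 / 2) ^ p := by
  set T := (2 * R) ^ (1 / a) with hT
  have hT0 : 0 < T := by positivity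
  have hG : 0 < Real.Gamma (p * a + 1) := Real.Gamma_pos_of_pos (by positivity)
  have hpow : T ^ ((p : ℝ) * a) = (2 * R) ^ p := by
    rw [hT, ← Real.rpow_mul (by positivity), ← Real.rpow_natCast]
    congr 1
    field_simp
  have hGamma := rpow_mul_exp_neg_le_Gamma (by positivity : 0 ≤ p * a) hT0
  rw [hpow] at hGamma
  rw [norm_div, norm_pow, Real.norm_eq_abs, Real.norm_of_nonneg hG.le, div_le_iff₀ hG]
  calc |x| ^ p ≤ R ^ p := pow_le_pow_left₀ (abs_nonneg _) hx p
    _ = Real.exp T * (1 / 2) ^ p * ((2 * R) ^ p * Real.exp (-T)) := by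
        rw [Real.exp_neg, mul_pow, one_div, inv_pow]
        field_simp
    _ ≤ Real.exp T * (1 / 2) ^ p * Real.Gamma (p * a + 1) :=
        mul_le_mul_of_nonneg_left hGamma (by positivity)

theorem summable_mittagLeffler {a : ℝ} (ha : 0 < a) (x : ℝ) :
    Summable fun p : ℕ => x ^ p / Real.Gamma (p * a + 1) :=
  .of_norm_bounded (summable_geometric_two.mul_left _)
    (norm_mittagLeffler_term_le ha (R := |x| + 1) (by positivity) (by linarith))

theorem continuous_mittagLeffler {a : ℝ} (ha : 0 < a) : Continuous (mittagLeffler a) := by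
  refine continuous_iff_continuousAt.2 fun x => ?_
  have hball : ContinuousOn (mittagLeffler a) (Metric.closedBall 0 (|x| + 1)) :=
    continuousOn_tsum (fun p => by fun_prop) (summable_geometric_two.mul_left _)
      fun p y hy => norm_mittagLeffler_term_le ha (R := |x| + 1) (by positivity)
        (by simpa using hy) p
  exact hball.continuousAt (Metric.closedBall_mem_nhds_of_mem (by simp))

theorem mittagLeffler_zero (a : ℝ) : mittagLeffler a 0 = 1 := by
  rw [mittagLeffler, tsum_eq_single 0 fun p hp => by simp [hp]]
  simp

theorem integral_exp_neg_mul_mul_rpow {b l : ℝ} (hb : 0 ≤ b) (hl : 0 < l) :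
    ∫ t in Set.Ioi (0 : ℝ), Real.exp (-(l * t)) * t ^ b = l⁻¹ * l⁻¹ ^ b * Real.Gamma (b + 1) := by
  have h := Real.integral_rpow_mul_exp_neg_mul_Ioi (a := b + 1) (by linarith) hl
  simp only [add_sub_cancel_right, one_div] at h
  simp_rw [mul_comm (Real.exp _)]
  rw [h, Real.rpow_add (by positivity), Real.rpow_one, mul_comm (l⁻¹ ^ b)]

theorem integrableOn_exp_neg_mul_mul_rpow {b l : ℝ} (hb : 0 ≤ b) (hl : 0 < l) :
    IntegrableOn (fun t : ℝ => Real.exp (-(l * t)) * t ^ b) (Set.Ioi 0) := by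
  refine .of_integral_ne_zero ?_
  rw [integral_exp_neg_mul_mul_rpow hb hl]
  have := Real.Gamma_pos_of_pos (by linarith : 0 < b + 1)
  positivity

/-- The `p`-th term of the series of `e^(-l t) E_a(κ tᵃ)`. -/
noncomputable def laplaceMittagLefflerTerm (a κ l : ℝ) (p : ℕ) (t : ℝ) : ℝ :=
  κ ^ p / Real.Gamma (p * a + 1) * (Real.exp (-(l * t)) * t ^ (p * a))

theorem hasSum_laplaceMittagLefflerTerm {a : ℝ} (ha : 0 < a) (κ l : ℝ) {t : ℝ} (ht : 0 < t) :
    HasSum (fun p => laplaceMittagLefflerTerm a κ l p t)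
      (Real.exp (-(l * t)) * mittagLeffler a (κ * t ^ a)) := by
  refine ((summable_mittagLeffler ha (κ * t ^ a)).hasSum.mul_left
    (Real.exp (-(l * t)))).congr_fun fun p => ?_
  rw [laplaceMittagLefflerTerm, mul_pow, mul_comm (p : ℝ) a, Real.rpow_mul ht.le,
    Real.rpow_natCast]
  ring

theorem integrableOn_laplaceMittagLefflerTerm {a l : ℝ} (ha : 0 < a) (κ : ℝ) (hl : 0 < l)
    (p : ℕ) : IntegrableOn (laplaceMittagLefflerTerm a κ l p) (Set.Ioi 0) :=
  (integrableOn_exp_neg_mul_mul_rpow (by positivity) hl).const_mul _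

theorem integral_laplaceMittagLefflerTerm {a l : ℝ} (ha : 0 < a) (κ : ℝ) (hl : 0 < l) (p : ℕ) :
    ∫ t in Set.Ioi 0, laplaceMittagLefflerTerm a κ l p t = l⁻¹ * (κ * l⁻¹ ^ a) ^ p := by
  have hG := (Real.Gamma_pos_of_pos (by positivity : 0 < p * a + 1)).ne'
  simp only [laplaceMittagLefflerTerm]
  rw [integral_const_mul, integral_exp_neg_mul_mul_rpow (by positivity) hl, mul_comm (p : ℝ) a,
    Real.rpow_mul (by positivity), Real.rpow_natCast, mul_pow, mul_comm a]
  field_simp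

theorem norm_laplaceMittagLefflerTerm {a : ℝ} (ha : 0 < a) (κ l : ℝ) (p : ℕ) {t : ℝ}
    (ht : 0 < t) :
    ‖laplaceMittagLefflerTerm a κ l p t‖ = laplaceMittagLefflerTerm a |κ| l p t := by
  have hG := Real.Gamma_pos_of_pos (by positivity : 0 < p * a + 1)
  rw [laplaceMittagLefflerTerm, laplaceMittagLefflerTerm, norm_mul, norm_div, norm_pow,
    Real.norm_eq_abs κ, Real.norm_of_nonneg hG.le, Real.norm_of_nonneg (by positivity)]

theorem integral_exp_neg_mul_mittagLeffler {a κ l : ℝ} (ha : 0 < a) (hl : 0 < l)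
    (hκ : |κ| * l⁻¹ ^ a < 1) :
    ∫ t in Set.Ioi 0, Real.exp (-(l * t)) * mittagLeffler a (κ * t ^ a)
      = l⁻¹ * (1 - κ * l⁻¹ ^ a)⁻¹ := by
  have hnorm (p : ℕ) : ∫ t in Set.Ioi 0, ‖laplaceMittagLefflerTerm a κ l p t‖
      = l⁻¹ * (|κ| * l⁻¹ ^ a) ^ p := by
    rw [← integral_laplaceMittagLefflerTerm ha _ hl]
    exact setIntegral_congr_fun measurableSet_Ioi fun t ht =>
      norm_laplaceMittagLefflerTerm ha κ l p ht
  have hsummable :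
      Summable fun p => ∫ t in Set.Ioi 0, ‖laplaceMittagLefflerTerm a κ l p t‖ := by
    simp_rw [hnorm]
    exact (summable_geometric_of_lt_one (by positivity) hκ).mul_left _
  have hsum := hasSum_integral_of_summable_integral_norm
    (integrableOn_laplaceMittagLefflerTerm ha κ hl) hsummable
  simp_rw [integral_laplaceMittagLefflerTerm ha κ hl] at hsum
  rw [setIntegral_congr_fun measurableSet_Ioi fun t ht =>
    (hasSum_laplaceMittagLefflerTerm ha κ l ht).tsum_eq.symm]
  refine hsum.unique ((hasSum_geometric_of_abs_lt_one ?_).mul_left l⁻¹)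
  rwa [abs_mul, abs_of_nonneg (by positivity : 0 ≤ l⁻¹ ^ a)]

theorem integrableOn_exp_neg_mul_mittagLeffler {a κ l : ℝ} (ha : 0 < a) (hl : 0 < l)
    (hκ : |κ| * l⁻¹ ^ a < 1) :
    IntegrableOn (fun t => Real.exp (-(l * t)) * mittagLeffler a (κ * t ^ a)) (Set.Ioi 0) := by
  refine .of_integral_ne_zero ?_
  rw [integral_exp_neg_mul_mittagLeffler ha hl hκ]
  have hle : κ * l⁻¹ ^ a ≤ |κ| * l⁻¹ ^ a :=
    mul_le_mul_of_nonneg_right (le_abs_self κ) (by positivity)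
  have : 0 < 1 - κ * l⁻¹ ^ a := by linarith
  positivity

end MittagLeffler

/-- A nearest-neighbour Markov chain on `ℕ`, reflected at `0`, given by its transition
probabilities `up x` from `x` to `x + 1` and `down x` from `x` to `x - 1`. -/
structure BirthDeathChain where
  up : ℕ → ℝ
  down : ℕ → ℝ
  up_pos : ∀ x, 0 < up x
  down_nonneg : ∀ x, 0 ≤ down x
  up_add_down : ∀ x, up x + down x = 1
  down_zero : down 0 = 0

namespace BirthDeathChain

variable (C : BirthDeathChain)

/-- The transition operator `f ↦ (x ↦ 𝔼ₓ f(S₁))`. The junk value of `x - 1` at `x = 0` has the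
weight `down 0 = 0`. -/
def step : (ℕ → ℝ) →ₗ[ℝ] (ℕ → ℝ) where
  toFun f x := C.up x * f (x + 1) + C.down x * f (x - 1)
  map_add' f g := by
    ext x
    simp only [Pi.add_apply]
    ring
  map_smul' c f := by
    ext x
    simp only [Pi.smul_apply, smul_eq_mul, RingHom.id_apply]
    ring

theorem step_apply (f : ℕ → ℝ) (x : ℕ) :
    C.step f x = C.up x * f (x + 1) + C.down x * f (x - 1) := rfl

theorem step_zero (f : ℕ → ℝ) : C.step f 0 = f 1 := by
  have h := C.up_add_down 0
  rw [C.down_zero, add_zero] at h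
  simp [step_apply, h, C.down_zero]

theorem step_succ (f : ℕ → ℝ) (x : ℕ) :
    C.step f (x + 1) = C.up (x + 1) * f (x + 2) + C.down (x + 1) * f x := rfl

theorem step_const (c : ℝ) : C.step (fun _ => c) = fun _ => c := by
  ext x
  rw [step_apply, ← add_mul, C.up_add_down, one_mul]

variable {C} in
theorem step_mono {f g : ℕ → ℝ} (h : f ≤ g) : C.step f ≤ C.step g := fun x =>
  add_le_add (mul_le_mul_of_nonneg_left (h _) (C.up_pos x).le)
    (mul_le_mul_of_nonneg_left (h _) (C.down_nonneg x))

theorem step_single_zero : C.step (Pi.single 0 1) = C.down 1 • Pi.single 1 1 := by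
  ext x
  rcases x with _ | _ | x
  · simp [step_zero]
  · simp [step_succ]
  · simp [step_succ]

theorem step_single_succ (y : ℕ) :
    C.step (Pi.single (y + 1) 1)
      = C.up y • Pi.single y 1 + C.down (y + 2) • Pi.single (y + 2) 1 := by
  ext x
  simp only [step_apply, Pi.add_apply, Pi.smul_apply, smul_eq_mul, Pi.single_apply,
    Nat.add_right_cancel_iff]
  rcases x with _ | x
  · rcases y with _ | y <;> simp [C.down_zero]
  · simp only [Nat.add_sub_cancel]
    grind

/-- The `n`-step transition probabilities `pⁿ(x, y)`. -/
def nStep (n x y : ℕ) : ℝ := (C.step ^ n) (Pi.single y 1) x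

theorem nStep_zero (x y : ℕ) : C.nStep 0 x y = (Pi.single y 1 : ℕ → ℝ) x := rfl

theorem nStep_succ (n x y : ℕ) :
    C.nStep (n + 1) x y = C.step (fun x => C.nStep n x y) x := by
  rw [nStep, pow_succ', Module.End.mul_apply]
  rfl

theorem nStep_succ_zero_right (n x : ℕ) :
    C.nStep (n + 1) x 0 = C.down 1 * C.nStep n x 1 := by
  rw [nStep, pow_succ, Module.End.mul_apply, step_single_zero, map_smul]
  rfl

theorem nStep_succ_succ_right (n x y : ℕ) :
    C.nStep (n + 1) x (y + 1)
      = C.up y * C.nStep n x y + C.down (y + 2) * C.nStep n x (y + 2) := by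
  rw [nStep, pow_succ, Module.End.mul_apply, step_single_succ, map_add, map_smul, map_smul]
  rfl

theorem nStep_mem_Icc (n x y : ℕ) : C.nStep n x y ∈ Set.Icc (0 : ℝ) 1 := by
  induction n generalizing x with
  | zero =>
    rw [nStep_zero, Pi.single_apply]
    split_ifs <;> simp
  | succ n ih =>
    have hlower := step_mono (C := C) (fun x => (ih x).1) x
    have hupper := step_mono (C := C) (fun x => (ih x).2) x
    rw [C.step_const] at hlower hupper
    rw [nStep_succ]
    exact ⟨hlower, hupper⟩

theorem nStep_eq_zero_of_lt {n x y : ℕ} (h : n + y < x) : C.nStep n x y = 0 := by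
  induction n generalizing x with
  | zero =>
    have hxy : x ≠ y := by omega
    simp [nStep_zero, hxy]
  | succ n ih =>
    obtain ⟨x, rfl⟩ : ∃ x', x = x' + 1 := ⟨x - 1, by omega⟩
    rw [nStep_succ, step_succ, ih (by omega), ih (by omega)]
    ring

theorem nStep_eq_zero_of_odd {n x y : ℕ} (h : Odd (n + x + y)) : C.nStep n x y = 0 := by
  induction n generalizing x with
  | zero =>
    have hxy : x ≠ y := by
      rintro rfl
      grind
    simp [nStep_zero, hxy]
  | succ n ih =>
    rcases x with _ | x
    · rw [nStep_succ, step_zero, ih (by grind)]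
    · rw [nStep_succ, step_succ, ih (by grind), ih (by grind)]
      ring

/-- Detailed balance: the weights `π` form a reversible measure of the chain. -/
def IsReversible (π : ℕ → ℝ) : Prop := ∀ y, π y * C.up y = π (y + 1) * C.down (y + 1)

variable {C} in
theorem nStep_reversible {π : ℕ → ℝ} (hπ : C.IsReversible π) (n x y : ℕ) :
    π x * C.nStep n x y = π y * C.nStep n y x := by
  induction n generalizing x with
  | zero =>
    rcases eq_or_ne x y with rfl | hxy
    · rfl
    · simp [nStep_zero, hxy, hxy.symm]
  | succ n ih =>
    rcases x with _ | x
    · have hπ0 := hπ 0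
      have h := C.up_add_down 0
      rw [C.down_zero, add_zero] at h
      rw [h, mul_one] at hπ0
      rw [nStep_succ_zero_right, nStep_succ, step_zero, hπ0]
      linear_combination C.down 1 * ih 1
    · rw [nStep_succ_succ_right, nStep_succ, step_succ]
      linear_combination C.nStep n (x + 2) y * hπ (x + 1) - C.nStep n x y * hπ x
        + C.down (x + 2) * ih (x + 2) + C.up x * ih x

/-- The Green function `G_z(x, y) = ∑ₙ zⁿ pⁿ(x, y)`. -/
noncomputable def green (z : ℝ) (x y : ℕ) : ℝ := ∑' n : ℕ, z ^ n * C.nStep n x y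

variable {C} in
theorem green_reversible {π : ℕ → ℝ} (hπ : C.IsReversible π)
    (z : ℝ) (x y : ℕ) : π x * C.green z x y = π y * C.green z y x := by
  rw [green, green, ← tsum_mul_left, ← tsum_mul_left]
  refine tsum_congr fun n => ?_
  rw [mul_left_comm, nStep_reversible hπ, mul_left_comm]

section Green

variable {z : ℝ} (hz : z ∈ Set.Ico (0 : ℝ) 1)
include hz

theorem summable_green (x y : ℕ) : Summable fun n : ℕ => z ^ n * C.nStep n x y :=
  (summable_geometric_of_lt_one hz.1 hz.2).of_nonneg_of_le
    (fun n => mul_nonneg (pow_nonneg hz.1 n) (C.nStep_mem_Icc n x y).1)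
    fun n => mul_le_of_le_one_right (pow_nonneg hz.1 n) (C.nStep_mem_Icc n x y).2

theorem green_nonneg (x y : ℕ) : 0 ≤ C.green z x y :=
  tsum_nonneg fun n => mul_nonneg (pow_nonneg hz.1 n) (C.nStep_mem_Icc n x y).1

theorem green_le (x y : ℕ) : C.green z x y ≤ (1 - z)⁻¹ := by
  rw [← tsum_geometric_of_lt_one hz.1 hz.2]
  exact (C.summable_green hz x y).tsum_le_tsum
    (fun n => mul_le_of_le_one_right (pow_nonneg hz.1 n) (C.nStep_mem_Icc n x y).2)
    (summable_geometric_of_lt_one hz.1 hz.2)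

theorem green_eq (x y : ℕ) :
    C.green z x y = (Pi.single y 1 : ℕ → ℝ) x + z * C.step (fun x => C.green z x y) x := by
  have hup := (C.summable_green hz (x + 1) y).mul_left (C.up x)
  have hdown := (C.summable_green hz (x - 1) y).mul_left (C.down x)
  rw [green, (C.summable_green hz x y).tsum_eq_zero_add, pow_zero, one_mul, nStep_zero,
    step_apply, green, green, ← tsum_mul_left, ← tsum_mul_left, ← hup.tsum_add hdown,
    ← tsum_mul_left]
  congr 1
  refine tsum_congr fun n => ?_
  rw [nStep_succ, step_apply]
  ring

end Green

section Asymptotics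

variable {C} {ι : Type*} {F : Filter ι} {z L : ι → ℝ} {c : ℝ} (hz : Tendsto z F (𝓝[<] 1))
  (hL : Tendsto L F atTop)
include hz hL

theorem tendsto_green_succ {x y : ℕ} (h : Tendsto (fun i => C.green (z i) x y / L i) F (𝓝 c))
    (h' : Tendsto (fun i => C.green (z i) (x - 1) y / L i) F (𝓝 c)) :
    Tendsto (fun i => C.green (z i) (x + 1) y / L i) F (𝓝 c) := by
  have hup := (C.up_pos x).ne'
  have hsingle : Tendsto (fun i => (Pi.single y 1 : ℕ → ℝ) x / L i) F (𝓝 0) :=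
    tendsto_const_nhds.div_atTop hL
  have hlim := (((h.sub hsingle).div (hz.mono_right nhdsWithin_le_nhds) one_ne_zero).sub
    (h'.const_mul (C.down x))).div_const (C.up x)
  have hc : ((c - 0) / 1 - C.down x * c) / C.up x = c := by
    rw [div_eq_iff hup]
    linear_combination -c * C.up_add_down x
  rw [hc] at hlim
  refine hlim.congr' ?_
  filter_upwards [hz (Ioo_mem_nhdsLT one_pos)] with i hi
  have hzi : z i ≠ 0 := hi.1.ne'
  simp only [Pi.div_apply]
  rw [C.green_eq ⟨hi.1.le, hi.2⟩ x y, step_apply]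
  field_simp
  ring

theorem tendsto_green_of_zero_left {y : ℕ}
    (h : Tendsto (fun i => C.green (z i) 0 y / L i) F (𝓝 c)) (x : ℕ) :
    Tendsto (fun i => C.green (z i) x y / L i) F (𝓝 c) := by
  induction x using Nat.strong_induction_on with
  | _ x ih =>
    rcases x with _ | x
    · exact h
    · exact tendsto_green_succ hz hL (ih x (by omega)) (ih (x - 1) (by omega))

theorem tendsto_green {π : ℕ → ℝ} (hπ : C.IsReversible π)
    (hπ0 : π 0 = 1) (h : Tendsto (fun i => C.green (z i) 0 0 / L i) F (𝓝 c)) (x y : ℕ) :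
    Tendsto (fun i => C.green (z i) x y / L i) F (𝓝 (π y * c)) := by
  refine tendsto_green_of_zero_left hz hL ?_ x
  refine ((tendsto_green_of_zero_left hz hL h y).const_mul (π y)).congr fun i => ?_
  rw [← mul_div_assoc, ← green_reversible hπ, hπ0, one_mul]

end Asymptotics

end BirthDeathChain

section PowerSeries

theorem summable_mul_pow_of_isLittleO {e b : ℕ → ℝ} (he : e =o[atTop] b) {v : ℝ}
    (hb : Summable fun k => b k * v ^ k) : Summable fun k => e k * v ^ k :=
  summable_of_isBigO_nat hb (he.isBigO.mul (Asymptotics.isBigO_refl _ _))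

theorem exists_abs_tsum_mul_pow_le {e b : ℕ → ℝ} (hb : ∀ k, 0 ≤ b k) (he : e =o[atTop] b)
    (hbs : ∀ v ∈ Set.Ico (0 : ℝ) 1, Summable fun k => b k * v ^ k) {ε : ℝ} (hε : 0 < ε) :
    ∃ A, ∀ v ∈ Set.Ico (0 : ℝ) 1, |∑' k, e k * v ^ k| ≤ A + ε * ∑' k, b k * v ^ k := by
  obtain ⟨K, hK⟩ := eventually_atTop.1 (he.def hε)
  set head : ℕ → ℝ := fun k => if k ∈ Finset.range K then |e k| else 0
  have hhead : HasSum head (∑ k ∈ Finset.range K, head k) :=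
    hasSum_sum_of_ne_finset_zero fun k hk => if_neg hk
  refine ⟨∑ k ∈ Finset.range K, head k, fun v hv => ?_⟩
  rw [← Real.norm_eq_abs]
  refine tsum_of_norm_bounded (hhead.add ((hbs v hv).hasSum.mul_left ε)) fun k => ?_
  have hvk : 0 ≤ v ^ k := pow_nonneg hv.1 k
  rw [norm_mul, Real.norm_of_nonneg hvk, Real.norm_eq_abs]
  rcases lt_or_ge k K with hk | hk
  · have htail : 0 ≤ ε * (b k * v ^ k) := mul_nonneg hε.le (mul_nonneg (hb k) hvk)
    have hle := mul_le_of_le_one_right (abs_nonneg (e k)) (pow_le_one₀ hv.1 hv.2.le (n := k))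
    simp only [head, Finset.mem_range, hk, if_true]
    linarith
  · have hek := mul_le_mul_of_nonneg_right (hK k hk) hvk
    rw [Real.norm_eq_abs, Real.norm_of_nonneg (hb k), mul_assoc] at hek
    simpa [head, hk.not_gt] using hek

variable {ι : Type*} {F : Filter ι} {w L : ι → ℝ} {d : ℝ}

theorem tendsto_tsum_mul_pow_div_zero {e b : ℕ → ℝ} (hb : ∀ k, 0 ≤ b k) (he : e =o[atTop] b)
    (hbs : ∀ v ∈ Set.Ico (0 : ℝ) 1, Summable fun k => b k * v ^ k)
    (hw : ∀ᶠ i in F, w i ∈ Set.Ico (0 : ℝ) 1) (hL : Tendsto L F atTop)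
    (h : Tendsto (fun i => (∑' k, b k * w i ^ k) / L i) F (𝓝 d)) :
    Tendsto (fun i => (∑' k, e k * w i ^ k) / L i) F (𝓝 0) := by
  refine Metric.tendsto_nhds.2 fun ε hε => ?_
  obtain ⟨A, hA⟩ := exists_abs_tsum_mul_pow_le hb he hbs
    (by positivity : 0 < ε / (2 * (|d| + 1)))
  have hlim : ∀ᶠ i in F, A / L i + ε / (2 * (|d| + 1)) * ((∑' k, b k * w i ^ k) / L i) < ε := by
    refine ((tendsto_const_nhds.div_atTop hL).add (h.const_mul _)).eventually_lt_const ?_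
    rw [zero_add, div_mul_eq_mul_div, div_lt_iff₀ (by positivity)]
    exact mul_lt_mul_of_pos_left (by linarith [le_abs_self d, abs_nonneg d]) hε
  filter_upwards [hw, hlim, hL.eventually_gt_atTop 0] with i hi hlt hLi
  rw [Real.dist_eq, sub_zero, abs_div, abs_of_pos hLi]
  refine lt_of_le_of_lt ?_ hlt
  rw [← mul_div_assoc, ← add_div]
  exact div_le_div_of_nonneg_right (hA _ hi) hLi.le

theorem tendsto_tsum_mul_pow_div {a b : ℕ → ℝ} {c : ℝ} (hb : ∀ k, 0 ≤ b k)
    (hab : (fun k => a k - c * b k) =o[atTop] b)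
    (hbs : ∀ v ∈ Set.Ico (0 : ℝ) 1, Summable fun k => b k * v ^ k)
    (hw : ∀ᶠ i in F, w i ∈ Set.Ico (0 : ℝ) 1) (hL : Tendsto L F atTop)
    (h : Tendsto (fun i => (∑' k, b k * w i ^ k) / L i) F (𝓝 d)) :
    Tendsto (fun i => (∑' k, a k * w i ^ k) / L i) F (𝓝 (c * d)) := by
  have hsum := (tendsto_tsum_mul_pow_div_zero hb hab hbs hw hL h).add (h.const_mul c)
  rw [zero_add] at hsum
  refine hsum.congr' ?_
  filter_upwards [hw] with i hi
  have hbi := hbs _ hi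
  rw [← mul_div_assoc, ← add_div, ← tsum_mul_left,
    ← (summable_mul_pow_of_isLittleO hab hbi).tsum_add (hbi.mul_left c)]
  congr 2 with k
  ring

theorem isLittleO_sub_const_mul_of_tendsto_div {a b : ℕ → ℝ} {c : ℝ}
    (hb : ∀ᶠ k in atTop, b k ≠ 0) (h : Tendsto (fun k => a k / b k) atTop (𝓝 c)) :
    (fun k => a k - c * b k) =o[atTop] b := by
  refine (Asymptotics.isLittleO_iff_tendsto' (hb.mono fun k hk h0 => (hk h0).elim)).2 ?_
  rw [← sub_self c]
  refine (h.sub_const c).congr' ?_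
  filter_upwards [hb] with k hk
  field_simp

end PowerSeries

section Pochhammer

theorem ascPochhammer_eval_eq_prod_range (s : ℝ) (k : ℕ) :
    (ascPochhammer ℝ k).eval s = ∏ j ∈ Finset.range k, (s + j) := by
  induction k with
  | zero => simp
  | succ k ih => rw [ascPochhammer_succ_eval, ih, Finset.prod_range_succ]

theorem ascPochhammer_eval_add_one_mul (s : ℝ) (k : ℕ) :
    (ascPochhammer ℝ k).eval (s + 1) * s = (ascPochhammer ℝ k).eval s * (s + k) := by
  rw [← ascPochhammer_succ_eval, ascPochhammer_succ_left]
  simp [mul_comm]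

theorem tendsto_ascPochhammer_ratio {s₁ s₂ t₁ t₂ : ℝ} (hs₁ : 0 < s₁) (hs₂ : 0 < s₂)
    (ht₁ : 0 < t₁) (ht₂ : 0 < t₂) (h : s₁ + s₂ = t₁ + t₂) :
    Tendsto (fun k => (ascPochhammer ℝ k).eval t₁ * (ascPochhammer ℝ k).eval t₂ /
        ((ascPochhammer ℝ k).eval s₁ * (ascPochhammer ℝ k).eval s₂)) atTop
      (𝓝 (Real.Gamma s₁ * Real.Gamma s₂ / (Real.Gamma t₁ * Real.Gamma t₂))) := by
  rw [← tendsto_add_atTop_iff_nat 1]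
  have hlim := ((Real.GammaSeq_tendsto_Gamma s₁).mul (Real.GammaSeq_tendsto_Gamma s₂)).div
    ((Real.GammaSeq_tendsto_Gamma t₁).mul (Real.GammaSeq_tendsto_Gamma t₂))
    (mul_pos (Real.Gamma_pos_of_pos ht₁) (Real.Gamma_pos_of_pos ht₂)).ne'
  refine hlim.congr' ?_
  filter_upwards [eventually_gt_atTop 0] with k hk
  have hk' : (0 : ℝ) < k := by exact_mod_cast hk
  have hpow : (k : ℝ) ^ s₁ * (k : ℝ) ^ s₂ = (k : ℝ) ^ t₁ * (k : ℝ) ^ t₂ := by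
    rw [← Real.rpow_add hk', ← Real.rpow_add hk', h]
  have h₁ := ascPochhammer_pos (k + 1) s₁ hs₁
  have h₂ := ascPochhammer_pos (k + 1) s₂ hs₂
  have h₃ := ascPochhammer_pos (k + 1) t₁ ht₁
  have h₄ := ascPochhammer_pos (k + 1) t₂ ht₂
  have : 0 < (k : ℝ) ^ t₁ := by positivity
  have : 0 < (k : ℝ) ^ t₂ := by positivity
  simp only [Pi.div_apply, Real.GammaSeq, ← ascPochhammer_eval_eq_prod_range]
  field_simp
  linear_combination hpow

theorem ringChoose_eq_ascPochhammer (a : ℝ) (k : ℕ) :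
    Ring.choose (a + k - 1) k = (ascPochhammer ℝ k).eval a / k.factorial := by
  rw [eq_div_iff (by positivity), mul_comm, ← nsmul_eq_mul,
    ← Ring.descPochhammer_eq_factorial_smul_choose,
    Polynomial.descPochhammer_smeval_eq_ascPochhammer, Polynomial.ascPochhammer_smeval_cast,
    Polynomial.ascPochhammer_smeval_eq_eval]
  ring_nf

theorem hasSum_ascPochhammer_mul_pow (a : ℝ) {w : ℝ} (hw : w ∈ Set.Ico (0 : ℝ) 1) :
    HasSum (fun k : ℕ => (ascPochhammer ℝ k).eval a / k.factorial * w ^ k) ((1 - w) ^ (-a)) := by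
  have h := (Real.one_div_one_sub_rpow_hasFPowerSeriesOnBall_zero a).hasSum (y := w) (by
    rw [← ENNReal.ofReal_one, Metric.eball_ofReal]
    simpa [abs_of_nonneg hw.1] using hw.2)
  simp only [FormalMultilinearSeries.ofScalars_apply_eq, zero_add, smul_eq_mul,
    ringChoose_eq_ascPochhammer] at h
  rwa [Real.rpow_neg (by linarith [hw.2]), ← one_div]

theorem hasSum_one_div_mul_pow {w : ℝ} (hw : w ∈ Set.Ico (0 : ℝ) 1) :
    HasSum (fun k : ℕ => 1 / (k : ℝ) * w ^ k) (-Real.log (1 - w)) := by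
  rw [← hasSum_nat_add_iff' 1]
  simpa [mul_comm, div_eq_mul_inv] using
    Real.hasSum_pow_div_log_of_abs_lt_one (x := w) (by rw [abs_of_nonneg hw.1]; exact hw.2)

theorem tendsto_tsum_ascPochhammer_mul_exp_pow_div_rpow (a : ℝ) {l : ℝ} (hl : 0 < l) :
    Tendsto (fun m : ℕ => (∑' k : ℕ, (ascPochhammer ℝ k).eval a / k.factorial *
      Real.exp (-(l / m)) ^ k) / (m : ℝ) ^ a) atTop (𝓝 (l ^ (-a))) := by
  refine ((tendsto_mul_one_sub_exp_neg_div l tendsto_natCast_atTop_atTop).rpow_const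
    (Or.inl hl.ne')).congr' ?_
  filter_upwards [eventually_gt_atTop 0] with m hm
  have hz := exp_neg_div_natCast_mem_Ico hl hm
  rw [(hasSum_ascPochhammer_mul_pow _ hz).tsum_eq,
    Real.mul_rpow m.cast_nonneg (by linarith [hz.2]), Real.rpow_neg m.cast_nonneg,
    inv_mul_eq_div]

theorem tendsto_log_natCast_atTop : Tendsto (fun m : ℕ => Real.log m) atTop atTop :=
  Real.tendsto_log_atTop.comp tendsto_natCast_atTop_atTop

theorem tendsto_tsum_one_div_mul_exp_pow_div_log {l : ℝ} (hl : 0 < l) :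
    Tendsto (fun m : ℕ => (∑' k : ℕ, 1 / (k : ℝ) * Real.exp (-(l / m)) ^ k) / Real.log m)
      atTop (𝓝 1) := by
  have hlim := tendsto_const_nhds (x := (1 : ℝ)).sub (((tendsto_mul_one_sub_exp_neg_div l
    tendsto_natCast_atTop_atTop).log hl.ne').div_atTop tendsto_log_natCast_atTop)
  rw [sub_zero] at hlim
  refine hlim.congr' ?_
  filter_upwards [eventually_gt_atTop 1] with m hm
  have hm0 : 0 < m := by omega
  have hz := exp_neg_div_natCast_mem_Ico hl hm0
  have hlog : 0 < Real.log m := Real.log_pos (by exact_mod_cast hm)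
  rw [(hasSum_one_div_mul_pow hz).tsum_eq, Real.log_mul (by positivity) (by linarith [hz.2])]
  field_simp
  ring

end Pochhammer

section Gegenbauer

variable {α : ℝ}

/-- The random walk on `ℕ` associated with the Gegenbauer polynomials of index `α`. The case
distinction only concerns `α = -1/2`, where the formula for `up 0` degenerates to `0 / 0`. -/
noncomputable def gegenbauerChain (hα : -1 < α) : BirthDeathChain where
  up x := if x = 0 then 1 else (x + 2 * α + 1) / (2 * x + 2 * α + 1)
  down x := x / (2 * x + 2 * α + 1)
  up_pos x := by
    split_ifs with hx
    · exact one_pos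
    · have : (1 : ℝ) ≤ x := by exact_mod_cast Nat.one_le_iff_ne_zero.2 hx
      exact div_pos (by linarith) (by linarith)
  down_nonneg x := by
    rcases x with _ | x
    · simp
    · refine div_nonneg (by positivity) ?_
      push_cast
      linarith [x.cast_nonneg (α := ℝ)]
  up_add_down x := by
    split_ifs with hx
    · simp [hx]
    · have : (1 : ℝ) ≤ x := by exact_mod_cast Nat.one_le_iff_ne_zero.2 hx
      rw [← add_div, div_eq_one_iff_eq (by linarith)]
      ring
  down_zero := by simp

theorem gegenbauerChain_up_zero (hα : -1 < α) : (gegenbauerChain hα).up 0 = 1 := by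
  simp [gegenbauerChain]

theorem gegenbauerChain_up_succ (hα : -1 < α) (x : ℕ) :
    (gegenbauerChain hα).up (x + 1) = (x + 2 * α + 2) / (2 * x + 2 * α + 3) := by
  simp only [gegenbauerChain, if_neg x.succ_ne_zero]
  push_cast
  congr 1 <;> ring

theorem gegenbauerChain_down_succ (hα : -1 < α) (x : ℕ) :
    (gegenbauerChain hα).down (x + 1) = (x + 1) / (2 * x + 2 * α + 3) := by
  simp only [gegenbauerChain]
  push_cast
  congr 1
  ring

theorem two_mul_add_two_mul_add_three_pos (hα : -1 < α) (x : ℕ) :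
    0 < 2 * (x : ℝ) + 2 * α + 3 := by
  linarith [x.cast_nonneg (α := ℝ)]

theorem gegenbauerWeight_zero (α : ℝ) : gegenbauerWeight α 0 = Real.Gamma (2 * α + 2) := by
  rw [gegenbauerWeight, Nat.cast_zero, mul_zero, zero_add,
    show 2 * α + 2 = 2 * α + 1 + 1 by ring]
  split_ifs with h
  · rw [h, zero_add, Real.Gamma_one]
  · rw [Real.Gamma_add_one h]

theorem gegenbauerWeight_succ (hα : -1 < α) (y : ℕ) :
    gegenbauerWeight α (y + 1) = (2 * y + 2 * α + 3) * Real.Gamma (y + 2 * α + 2) := by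
  rw [gegenbauerWeight, if_neg (by push_cast; linarith [y.cast_nonneg (α := ℝ)])]
  push_cast
  ring_nf

/-- The reversible measure `π` of the chain with `π 0 = 1`. -/
noncomputable def gegenbauerInvariant (α : ℝ) (y : ℕ) : ℝ :=
  gegenbauerWeight α y / (Real.Gamma (y + 1) * Real.Gamma (2 * α + 2))

theorem gegenbauerInvariant_zero_right (hα : -1 < α) : gegenbauerInvariant α 0 = 1 := by
  have : 0 < Real.Gamma (2 * α + 2) := Real.Gamma_pos_of_pos (by linarith)
  rw [gegenbauerInvariant, gegenbauerWeight_zero]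
  simp [this.ne']

theorem gegenbauerChain_up_mul_gegenbauerWeight (hα : -1 < α) (y : ℕ) :
    (gegenbauerChain hα).up y * gegenbauerWeight α y = Real.Gamma (y + 2 * α + 2) := by
  rcases y with _ | y
  · rw [gegenbauerChain_up_zero, gegenbauerWeight_zero, one_mul, Nat.cast_zero, zero_add]
  · have hy : 0 < (y : ℝ) + 2 * α + 2 := by linarith [y.cast_nonneg (α := ℝ)]
    rw [gegenbauerChain_up_succ, gegenbauerWeight_succ hα, ← mul_assoc,
      div_mul_cancel₀ _ (two_mul_add_two_mul_add_three_pos hα y).ne', ← Real.Gamma_add_one hy.ne']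
    push_cast
    ring_nf

theorem gegenbauerChain_down_mul_gegenbauerWeight (hα : -1 < α) (y : ℕ) :
    (gegenbauerChain hα).down (y + 1) * gegenbauerWeight α (y + 1)
      = (y + 1) * Real.Gamma (y + 2 * α + 2) := by
  rw [gegenbauerChain_down_succ, gegenbauerWeight_succ hα, ← mul_assoc,
    div_mul_cancel₀ _ (two_mul_add_two_mul_add_three_pos hα y).ne']

theorem isReversible_gegenbauerInvariant (hα : -1 < α) :
    (gegenbauerChain hα).IsReversible (gegenbauerInvariant α) := by
  intro y
  have hy : (y : ℝ) + 1 ≠ 0 := by positivity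
  rw [gegenbauerInvariant, gegenbauerInvariant, div_mul_eq_mul_div, div_mul_eq_mul_div,
    mul_comm _ ((gegenbauerChain hα).up y), gegenbauerChain_up_mul_gegenbauerWeight,
    mul_comm _ ((gegenbauerChain hα).down (y + 1)), gegenbauerChain_down_mul_gegenbauerWeight,
    Nat.cast_succ, Real.Gamma_add_one hy, mul_assoc, mul_div_mul_left _ _ hy]

/-- The closed form of the probability `p^(x + 2k)(x, 0)`. -/
noncomputable def gegenbauerReturnProb (α : ℝ) (k x : ℕ) : ℝ :=
  (1 / 2) ^ x * ((x + 2 * k).factorial / (2 * k).factorial) * (ascPochhammer ℝ k).eval (1 / 2) /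
    (ascPochhammer ℝ (k + x)).eval (α + 3 / 2)

theorem gegenbauerReturnProb_succ_zero (hα : -1 < α) (k : ℕ) :
    gegenbauerReturnProb α (k + 1) 0 = gegenbauerReturnProb α k 1 := by
  have := ascPochhammer_pos (k + 1) (α + 3 / 2) (by linarith)
  rw [gegenbauerReturnProb, gegenbauerReturnProb, ascPochhammer_succ_eval k (1 / 2),
    show 1 + 2 * k = 2 * k + 1 by ring, Nat.factorial_succ (2 * k)]
  simp only [zero_add, add_zero, pow_zero, pow_one]
  push_cast
  field_simp
  ring

theorem gegenbauerReturnProb_zero_succ (hα : -1 < α) (x : ℕ) :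
    gegenbauerReturnProb α 0 (x + 1)
      = (gegenbauerChain hα).down (x + 1) * gegenbauerReturnProb α 0 x := by
  have := ascPochhammer_pos x (α + 3 / 2) (by linarith)
  have := two_mul_add_two_mul_add_three_pos hα x
  have hfactor : α + 3 / 2 + (x : ℝ) = (2 * x + 2 * α + 3) / 2 := by ring
  rw [gegenbauerReturnProb, gegenbauerReturnProb, gegenbauerChain_down_succ]
  simp only [mul_zero, add_zero, zero_add, ascPochhammer_zero, Polynomial.eval_one,
    Nat.factorial_zero, Nat.factorial_succ, ascPochhammer_succ_eval, hfactor, pow_succ]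
  push_cast
  field_simp

theorem gegenbauerReturnProb_succ_succ (hα : -1 < α) (k x : ℕ) :
    gegenbauerReturnProb α (k + 1) (x + 1)
      = (gegenbauerChain hα).up (x + 1) * gegenbauerReturnProb α k (x + 2) +
        (gegenbauerChain hα).down (x + 1) * gegenbauerReturnProb α (k + 1) x := by
  have := ascPochhammer_pos (k + x + 1) (α + 3 / 2) (by linarith)
  have hD := two_mul_add_two_mul_add_three_pos hα x
  have hE : 0 < α + 3 / 2 + (k + x + 1) := by
    have : 0 < α + 3 / 2 := by linarith
    positivity
  simp only [gegenbauerReturnProb]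
  rw [gegenbauerChain_down_succ, gegenbauerChain_up_succ,
    show k + 1 + (x + 1) = k + x + 1 + 1 by ring, show k + (x + 2) = k + x + 1 + 1 by ring,
    show k + 1 + x = k + x + 1 by ring,
    show x + 1 + 2 * (k + 1) = x + 2 * k + 1 + 1 + 1 by ring,
    show x + 2 + 2 * k = x + 2 * k + 1 + 1 by ring,
    show x + 2 * (k + 1) = x + 2 * k + 1 + 1 by ring,
    show 2 * (k + 1) = 2 * k + 1 + 1 by ring]
  simp only [Nat.factorial_succ, ascPochhammer_succ_eval (k + x + 1), ascPochhammer_succ_eval k,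
    pow_succ]
  push_cast
  generalize (ascPochhammer ℝ (k + x + 1)).eval (α + 3 / 2) = Q at *
  generalize (ascPochhammer ℝ k).eval (1 / 2) = R
  generalize hD' : 2 * (x : ℝ) + 2 * α + 3 = D at *
  generalize hE' : α + 3 / 2 + ((k : ℝ) + x + 1) = E at *
  field_simp
  rw [← hE', ← hD']
  ring

theorem gegenbauerChain_nStep_add_two_mul (hα : -1 < α) (k x : ℕ) :
    (gegenbauerChain hα).nStep (x + 2 * k) x 0 = gegenbauerReturnProb α k x := by
  induction k generalizing x with
  | zero =>
    induction x with
    | zero => simp [BirthDeathChain.nStep_zero, gegenbauerReturnProb]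
    | succ x ih =>
      rw [mul_zero, add_zero] at ih ⊢
      rw [BirthDeathChain.nStep_succ, BirthDeathChain.step_succ, ih,
        BirthDeathChain.nStep_eq_zero_of_lt _ (by omega), gegenbauerReturnProb_zero_succ hα]
      ring
  | succ k ihk =>
    induction x with
    | zero =>
      rw [show 0 + 2 * (k + 1) = 1 + 2 * k + 1 by ring, BirthDeathChain.nStep_succ,
        BirthDeathChain.step_zero, ihk, gegenbauerReturnProb_succ_zero hα]
    | succ x ihx =>
      have hx := ihk (x + 2)
      rw [show x + 2 + 2 * k = x + 2 * (k + 1) by ring] at hx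
      rw [show x + 1 + 2 * (k + 1) = x + 2 * (k + 1) + 1 by ring, BirthDeathChain.nStep_succ,
        BirthDeathChain.step_succ, ihx, hx, gegenbauerReturnProb_succ_succ hα]

theorem gegenbauerChain_green_zero_zero (hα : -1 < α) (z : ℝ) :
    (gegenbauerChain hα).green z 0 0 = ∑' k : ℕ, (ascPochhammer ℝ k).eval (1 / 2) /
      (ascPochhammer ℝ k).eval (α + 3 / 2) * (z ^ 2) ^ k := by
  have hinj : Function.Injective fun k : ℕ => 2 * k := fun a b h => by simpa using h
  rw [BirthDeathChain.green, ← hinj.tsum_eq]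
  · refine tsum_congr fun k => ?_
    have hk := gegenbauerChain_nStep_add_two_mul hα k 0
    rw [zero_add] at hk
    rw [hk, gegenbauerReturnProb, ← pow_mul, mul_comm]
    simp [Nat.factorial_ne_zero]
  · intro n hn
    by_contra hrange
    have hodd : Odd (n + 0 + 0) := by
      rw [add_zero, add_zero, ← Nat.not_even_iff_odd]
      exact fun h => hrange (by obtain ⟨k, hk⟩ := h; exact ⟨k, by grind⟩)
    exact hn (by simp [BirthDeathChain.nStep_eq_zero_of_odd _ hodd])

theorem tendsto_gegenbauerChain_green_of_neg (hα : -1 < α) (hα' : α < 0) {l : ℝ} (hl : 0 < l) :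
    Tendsto (fun m : ℕ => (gegenbauerChain hα).green (Real.exp (-(l / m))) 0 0 / (m : ℝ) ^ (-α))
      atTop (𝓝 (Real.Gamma (α + 3 / 2) * Real.Gamma (-α) / Real.Gamma (1 / 2) * (2 * l) ^ α)) := by
  have hl2 : 0 < 2 * l := by linarith
  have hcoeff (k : ℕ) : 0 < (ascPochhammer ℝ k).eval (-α) / k.factorial :=
    div_pos (ascPochhammer_pos k _ (by linarith)) (by positivity)
  have hratio := tendsto_ascPochhammer_ratio (s₁ := α + 3 / 2) (s₂ := -α) (t₁ := 1 / 2) (t₂ := 1)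
    (by linarith) (by linarith) (by norm_num) one_pos (by ring)
  simp only [ascPochhammer_eval_one, Real.Gamma_one, mul_one] at hratio
  have hseries := tendsto_tsum_ascPochhammer_mul_exp_pow_div_rpow (-α) hl2
  rw [neg_neg] at hseries
  simp_rw [gegenbauerChain_green_zero_zero, exp_neg_div_natCast_sq]
  exact tendsto_tsum_mul_pow_div (fun k => (hcoeff k).le)
    (isLittleO_sub_const_mul_of_tendsto_div (.of_forall fun k => (hcoeff k).ne')
      (hratio.congr fun k => by rw [div_div_div_eq]))
    (fun v hv => (hasSum_ascPochhammer_mul_pow _ hv).summable)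
    ((eventually_gt_atTop 0).mono fun m hm => exp_neg_div_natCast_mem_Ico hl2 hm)
    ((tendsto_rpow_atTop (by linarith)).comp tendsto_natCast_atTop_atTop) hseries

theorem ascPochhammer_half_div_three_halves (k : ℕ) :
    (ascPochhammer ℝ k).eval (1 / 2) / (ascPochhammer ℝ k).eval (3 / 2) =
      1 / (2 * (k : ℝ) + 1) := by
  have hk := ascPochhammer_pos k (3 / 2 : ℝ) (by norm_num)
  have hshift := ascPochhammer_eval_add_one_mul (1 / 2) k
  rw [show (1 / 2 : ℝ) + 1 = 3 / 2 by norm_num] at hshift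
  rw [div_eq_div_iff hk.ne' (by positivity)]
  linarith

theorem tendsto_gegenbauerChain_green_of_zero {l : ℝ} (hl : 0 < l) :
    Tendsto (fun m : ℕ =>
      (gegenbauerChain neg_one_lt_zero).green (Real.exp (-(l / m))) 0 0 / Real.log m)
      atTop (𝓝 (1 / 2)) := by
  have hl2 : 0 < 2 * l := by linarith
  have hratio : Tendsto (fun k : ℕ => 1 / (2 * (k : ℝ) + 1) / (1 / (k : ℝ))) atTop
      (𝓝 (1 / 2)) := by
    have hlim : Tendsto (fun k : ℕ => 1 / (2 + 1 / (k : ℝ))) atTop (𝓝 (1 / (2 + 0))) :=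
      tendsto_const_nhds.div (tendsto_const_nhds.add tendsto_one_div_atTop_nhds_zero_nat)
        (by norm_num)
    rw [add_zero] at hlim
    refine hlim.congr' ?_
    filter_upwards [eventually_gt_atTop 0] with k hk
    field_simp
  simp_rw [gegenbauerChain_green_zero_zero, exp_neg_div_natCast_sq, zero_add,
    ascPochhammer_half_div_three_halves]
  rw [← mul_one (1 / 2 : ℝ)]
  refine tendsto_tsum_mul_pow_div (fun k => by positivity)
    (isLittleO_sub_const_mul_of_tendsto_div ?_ hratio)
    (fun v hv => (hasSum_one_div_mul_pow hv).summable)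
    ((eventually_gt_atTop 0).mono fun m hm => exp_neg_div_natCast_mem_Ico hl2 hm)
    tendsto_log_natCast_atTop (tendsto_tsum_one_div_mul_exp_pow_div_log hl2)
  filter_upwards [eventually_gt_atTop 0] with k hk
  positivity

end Gegenbauer

namespace BirthDeathChain

variable (C : BirthDeathChain)

section FeynmanKac

/-- The expectation `𝔼ₓ[∏_{k ≤ n} r(S_k)]`, defined by its recursion in `n`. -/
noncomputable def feynmanKac (r : ℕ → ℝ) : ℕ → ℕ → ℝ
  | 0 => r
  | n + 1 => r * C.step (feynmanKac r n)

variable {r : ℕ → ℝ} (hr₀ : 0 ≤ r)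
include hr₀

theorem feynmanKac_nonneg (n : ℕ) : 0 ≤ C.feynmanKac r n := by
  induction n with
  | zero => exact hr₀
  | succ n ih => exact mul_nonneg hr₀ (by simpa only [map_zero] using C.step_mono ih)

variable (hr₁ : r ≤ 1)
include hr₁

theorem antitone_feynmanKac : Antitone (C.feynmanKac r) := by
  refine antitone_nat_of_succ_le fun n => ?_
  induction n with
  | zero => exact mul_le_of_le_one_right hr₀ ((C.step_mono hr₁).trans (C.step_const 1).le)
  | succ n ih => exact mul_le_mul_of_nonneg_left (C.step_mono ih) hr₀

theorem feynmanKac_le_one (n : ℕ) : C.feynmanKac r n ≤ 1 :=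
  (C.antitone_feynmanKac hr₀ hr₁ n.zero_le).trans hr₁

variable {z : ℝ} (hz : z ∈ Set.Ico (0 : ℝ) 1)
include hz

theorem summable_feynmanKac (x : ℕ) : Summable fun n => z ^ n * C.feynmanKac r n x :=
  (summable_geometric_of_lt_one hz.1 hz.2).of_nonneg_of_le
    (fun n => mul_nonneg (pow_nonneg hz.1 n) (C.feynmanKac_nonneg hr₀ n x))
    fun n => mul_le_of_le_one_right (pow_nonneg hz.1 n) (C.feynmanKac_le_one hr₀ hr₁ n x)

theorem abs_tsum_feynmanKac_le (x : ℕ) :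
    |∑' n, z ^ n * C.feynmanKac r n x| ≤ (1 - z)⁻¹ := by
  rw [abs_of_nonneg (tsum_nonneg fun n =>
    mul_nonneg (pow_nonneg hz.1 n) (C.feynmanKac_nonneg hr₀ n x)),
    ← tsum_geometric_of_lt_one hz.1 hz.2]
  exact (C.summable_feynmanKac hr₀ hr₁ hz x).tsum_le_tsum
    (fun n => mul_le_of_le_one_right (pow_nonneg hz.1 n) (C.feynmanKac_le_one hr₀ hr₁ n x))
    (summable_geometric_of_lt_one hz.1 hz.2)

theorem tsum_feynmanKac_eq (x : ℕ) :
    ∑' n, z ^ n * C.feynmanKac r n x =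
      r x * (1 + z * C.step (fun x => ∑' n, z ^ n * C.feynmanKac r n x) x) := by
  have hsum := C.summable_feynmanKac hr₀ hr₁ hz
  have hup := (hsum (x + 1)).mul_left (C.up x)
  have hdown := (hsum (x - 1)).mul_left (C.down x)
  rw [(hsum x).tsum_eq_zero_add, step_apply, ← tsum_mul_left, ← tsum_mul_left,
    ← hup.tsum_add hdown, ← tsum_mul_left, mul_add, ← tsum_mul_left, pow_zero, one_mul, mul_one]
  congr 1
  refine tsum_congr fun n => ?_
  rw [feynmanKac, Pi.mul_apply, step_apply]
  ring

omit hr₀ hr₁ hz in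
theorem abs_step_le {f : ℕ → ℝ} {B : ℝ} (hf : ∀ x, |f x| ≤ B) (x : ℕ) : |C.step f x| ≤ B := by
  have hlower := C.step_mono (fun x => (abs_le.1 (hf x)).1) x
  have hupper := C.step_mono (fun x => (abs_le.1 (hf x)).2) x
  rw [C.step_const] at hlower hupper
  exact abs_le.2 ⟨hlower, hupper⟩

theorem eq_of_resolvent_eq {u v : ℕ → ℝ} {A B : ℝ} (hA : ∀ x, |u x| ≤ A) (hB : ∀ x, |v x| ≤ B)
    (hu : ∀ x, u x = r x * (1 + z * C.step u x)) (hv : ∀ x, v x = r x * (1 + z * C.step v x)) :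
    u = v := by
  have hdiff (x : ℕ) : (u - v) x = r x * (z * C.step (u - v) x) := by
    rw [Pi.sub_apply, hu x, hv x, map_sub, Pi.sub_apply]
    ring
  have hbound (n : ℕ) : ∀ x, |(u - v) x| ≤ z ^ n * (A + B) := by
    induction n with
    | zero => exact fun x => by simpa using (abs_sub _ _).trans (add_le_add (hA x) (hB x))
    | succ n ih =>
      intro x
      calc |(u - v) x| = r x * (z * |C.step (u - v) x|) := by
            rw [hdiff, abs_mul, abs_mul, abs_of_nonneg (hr₀ x), abs_of_nonneg hz.1]
        _ ≤ z * |C.step (u - v) x| :=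
            mul_le_of_le_one_left (mul_nonneg hz.1 (abs_nonneg _)) (hr₁ x)
        _ ≤ z * (z ^ n * (A + B)) := mul_le_mul_of_nonneg_left (C.abs_step_le ih x) hz.1
        _ = z ^ (n + 1) * (A + B) := by ring
  have hlim := (tendsto_pow_atTop_nhds_zero_of_lt_one hz.1 hz.2).mul_const (A + B)
  rw [zero_mul] at hlim
  ext x
  exact sub_eq_zero.1 (abs_nonpos_iff.1 (ge_of_tendsto' hlim fun n => hbound n x))

end FeynmanKac

section LocalTime

/-- The generating function `𝔼ₓ[ρ ^ Nₙ(y)]` of the local time at `y`. -/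
noncomputable def localTimePgf (ρ : ℝ) (y n x : ℕ) : ℝ :=
  C.feynmanKac (Function.update 1 y ρ) n x

theorem update_one_nonneg {ρ : ℝ} (hρ : 0 ≤ ρ) (y : ℕ) :
    0 ≤ Function.update (1 : ℕ → ℝ) y ρ :=
  le_update_iff.2 ⟨hρ, fun _ _ => zero_le_one⟩

theorem update_one_le_one {ρ : ℝ} (hρ : ρ ≤ 1) (y : ℕ) : Function.update (1 : ℕ → ℝ) y ρ ≤ 1 :=
  update_le_iff.2 ⟨hρ, fun _ _ => le_rfl⟩

/-- The closed form of the generating function `∑ₙ zⁿ 𝔼ₓ[ρ ^ Nₙ(y)]` in terms of the Green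
function. -/
noncomputable def localTimeResolvent (ρ z : ℝ) (y x : ℕ) : ℝ :=
  (1 - z)⁻¹ * (1 - (1 - ρ) * C.green z x y / (ρ + (1 - ρ) * C.green z y y))

section Resolvent

variable {ρ z : ℝ} (hρ₀ : 0 < ρ) (hρ₁ : ρ ≤ 1) (hz : z ∈ Set.Ico (0 : ℝ) 1)
include hρ₀ hρ₁ hz

theorem add_one_sub_mul_green_pos (y : ℕ) : 0 < ρ + (1 - ρ) * C.green z y y :=
  add_pos_of_pos_of_nonneg hρ₀ (mul_nonneg (sub_nonneg.2 hρ₁) (C.green_nonneg hz y y))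

theorem localTimeResolvent_eq (x y : ℕ) :
    C.localTimeResolvent ρ z y x =
      Function.update (1 : ℕ → ℝ) y ρ x * (1 + z * C.step (C.localTimeResolvent ρ z y) x) := by
  have hden := C.add_one_sub_mul_green_pos hρ₀ hρ₁ hz y
  have hz₁ : 1 - z ≠ 0 := (sub_pos.2 hz.2).ne'
  have hgreen := C.green_eq hz x y
  rw [step_apply] at hgreen
  have hstep : z * C.step (C.localTimeResolvent ρ z y) x =
      (1 - z)⁻¹ * (z - (1 - ρ) / (ρ + (1 - ρ) * C.green z y y) *
        (C.green z x y - (Pi.single y 1 : ℕ → ℝ) x)) := by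
    rw [step_apply, localTimeResolvent, localTimeResolvent]
    linear_combination (z * (1 - z)⁻¹) * C.up_add_down x +
      (1 - z)⁻¹ * ((1 - ρ) / (ρ + (1 - ρ) * C.green z y y)) * hgreen
  rw [hstep, localTimeResolvent]
  rcases eq_or_ne x y with rfl | hxy
  · rw [Function.update_self, Pi.single_eq_same]
    field_simp
    ring
  · rw [Function.update_of_ne hxy, Pi.single_eq_of_ne hxy, Pi.one_apply]
    field_simp
    ring

theorem abs_localTimeResolvent_le (x y : ℕ) :
    |C.localTimeResolvent ρ z y x| ≤
      (1 - z)⁻¹ * (1 + (1 - z)⁻¹ / (ρ + (1 - ρ) * C.green z y y)) := by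
  have hden := C.add_one_sub_mul_green_pos hρ₀ hρ₁ hz y
  have hg := C.green_nonneg hz x y
  have hquot : 0 ≤ (1 - ρ) * C.green z x y / (ρ + (1 - ρ) * C.green z y y) :=
    div_nonneg (mul_nonneg (sub_nonneg.2 hρ₁) hg) hden.le
  have hinv : 0 ≤ (1 - z)⁻¹ := inv_nonneg.2 (sub_nonneg.2 hz.2.le)
  rw [localTimeResolvent, abs_mul, abs_of_nonneg hinv]
  refine mul_le_mul_of_nonneg_left ((abs_sub _ _).trans ?_) hinv
  rw [abs_one, abs_of_nonneg hquot]
  gcongr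
  exact (mul_le_of_le_one_left hg (by linarith)).trans (C.green_le hz x y)

theorem tsum_localTimePgf (x y : ℕ) :
    ∑' n, z ^ n * C.localTimePgf ρ y n x = C.localTimeResolvent ρ z y x := by
  have hr₀ := update_one_nonneg hρ₀.le y
  have hr₁ := update_one_le_one hρ₁ y
  exact congrFun (C.eq_of_resolvent_eq hr₀ hr₁ hz (C.abs_tsum_feynmanKac_le hr₀ hr₁ hz)
    (C.abs_localTimeResolvent_le hρ₀ hρ₁ hz · y) (C.tsum_feynmanKac_eq hr₀ hr₁ hz)
    (C.localTimeResolvent_eq hρ₀ hρ₁ hz · y)) x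

end Resolvent

variable {C} {x y : ℕ} {l s : ℝ} {L : ℕ → ℝ} (hl : 0 < l) (hs : 0 ≤ s) (hL : Tendsto L atTop atTop)
include hl hs hL

theorem tendsto_abelMean_localTimePgf {c : ℝ}
    (hg : ∀ x, Tendsto (fun m : ℕ => C.green (Real.exp (-(l / m))) x y / L m) atTop (𝓝 c)) :
    Tendsto (fun m : ℕ => abelMean l (fun n => C.localTimePgf (Real.exp (-(s / L m))) y n x) m)
      atTop (𝓝 (l⁻¹ * (1 + s * c)⁻¹)) := by
  have hc : 0 ≤ c := by
    refine ge_of_tendsto (hg y) ?_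
    filter_upwards [eventually_gt_atTop 0, hL.eventually_ge_atTop 0] with m hm hLm
    exact div_nonneg (C.green_nonneg (exp_neg_div_natCast_mem_Ico hl hm) y y) hLm
  have hsc : 1 + s * c ≠ 0 := by positivity
  have hmass := (tendsto_mul_one_sub_exp_neg_div l (tendsto_natCast_atTop_atTop (R := ℝ))).inv₀
    hl.ne'
  have hscale := tendsto_mul_one_sub_exp_neg_div s hL
  have hρ : Tendsto (fun m => Real.exp (-(s / L m))) atTop (𝓝 1) := by
    simpa using (tendsto_const_nhds.div_atTop hL).neg.rexp
  have hlim := hmass.mul ((tendsto_const_nhds (x := (1 : ℝ))).sub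
    ((hscale.mul (hg x)).div (hρ.add (hscale.mul (hg y))) hsc))
  rw [one_sub_div hsc, add_sub_cancel_right, one_div] at hlim
  refine hlim.congr' ?_
  filter_upwards [eventually_gt_atTop 0, hL.eventually_gt_atTop 0] with m hm hLm
  have hρ₁ : Real.exp (-(s / L m)) ≤ 1 := Real.exp_le_one_iff.2 (neg_nonpos.2 (by positivity))
  have hcancel (x : ℕ) : L m * (1 - Real.exp (-(s / L m))) *
      (C.green (Real.exp (-(l / m))) x y / L m) =
        (1 - Real.exp (-(s / L m))) * C.green (Real.exp (-(l / m))) x y := by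
    field_simp
  simp only [abelMean, exp_neg_mul_natCast_div, Pi.div_apply, hcancel]
  rw [C.tsum_localTimePgf (Real.exp_pos _) hρ₁ (exp_neg_div_natCast_mem_Ico hl hm),
    localTimeResolvent, mul_inv, mul_assoc]

theorem tendsto_localTimePgf_of_green {c ψ : ℝ → ℝ} (hL₀ : ∀ m, 0 ≤ L m)
    (hg : ∀ l' ≥ l, ∀ x,
      Tendsto (fun m : ℕ => C.green (Real.exp (-(l' / m))) x y / L m) atTop (𝓝 (c l')))
    (hψ : ContinuousAt ψ 1)
    (hint : ∀ l' ≥ l, IntegrableOn (fun t => Real.exp (-(l' * t)) * ψ t) (Set.Ioi 0))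
    (hlaplace : ∀ l' ≥ l,
      ∫ t in Set.Ioi 0, Real.exp (-(l' * t)) * ψ t = l'⁻¹ * (1 + s * c l')⁻¹) :
    Tendsto (fun m => C.localTimePgf (Real.exp (-(s / L m))) y m x) atTop (𝓝 (ψ 1)) := by
  have hr₀ (m : ℕ) := update_one_nonneg (Real.exp_pos (-(s / L m))).le y
  have hr₁ (m : ℕ) := update_one_le_one
    (Real.exp_le_one_iff.2 (neg_nonpos.2 (div_nonneg hs (hL₀ m)))) y
  refine tendsto_diag_of_hasAbelLimit hl
    (fun m n n' hn => C.antitone_feynmanKac (hr₀ m) (hr₁ m) hn x) (fun k => ?_) hψ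
  have hk : l + k ≥ l := le_add_of_nonneg_right k.cast_nonneg
  refine ⟨⟨1, fun m n => ?_⟩, hint _ hk, ?_⟩
  · rw [abs_of_nonneg (C.feynmanKac_nonneg (hr₀ m) n x)]
    exact C.feynmanKac_le_one (hr₀ m) (hr₁ m) n x
  · rw [hlaplace _ hk]
    exact tendsto_abelMean_localTimePgf (hl.trans_le hk) hs hL (hg _ hk)

end LocalTime

end BirthDeathChain

section GegenbauerLocalTime

variable {α : ℝ}

theorem gegenbauerWeight_pos (hα : -1 < α) (y : ℕ) : 0 < gegenbauerWeight α y := by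
  rcases y with _ | y
  · rw [gegenbauerWeight_zero]
    exact Real.Gamma_pos_of_pos (by linarith)
  · rw [gegenbauerWeight_succ hα]
    exact mul_pos (two_mul_add_two_mul_add_three_pos hα y)
      (Real.Gamma_pos_of_pos (by linarith [y.cast_nonneg (α := ℝ)]))

theorem limitScale_pos (hα : -1 < α) (hα' : α < 0) (y : ℕ) : 0 < limitScale α y := by
  have hα₁ : 0 < Real.Gamma (α + 1) := Real.Gamma_pos_of_pos (by linarith)
  have hα₂ : 0 < Real.Gamma |α| := Real.Gamma_pos_of_pos (abs_pos.2 hα'.ne)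
  have : 0 < Real.Gamma (y + 1 : ℝ) := Real.Gamma_pos_of_pos (by positivity)
  have := gegenbauerWeight_pos hα y
  rw [limitScale]
  positivity

theorem limitScale_eq_gegenbauerInvariant_mul (hα : -1 < α) (hα' : α < 0) (y : ℕ) :
    limitScale α y = gegenbauerInvariant α y *
      (Real.Gamma (α + 3 / 2) * Real.Gamma (-α) / Real.Gamma (1 / 2) * 2 ^ α) := by
  have hdup : Real.Gamma (α + 1) * Real.Gamma (α + 3 / 2) * (2 ^ α * 2 ^ (α + 1)) =
      Real.Gamma (2 * α + 2) * √Real.pi := by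
    have h := Real.Gamma_mul_Gamma_add_half (α + 1)
    rw [show α + 1 + 1 / 2 = α + 3 / 2 by ring, show 2 * (α + 1) = 2 * α + 2 by ring,
      show 1 - (2 * α + 2) = -(α + (α + 1)) by ring, Real.rpow_neg two_pos.le] at h
    rw [h, ← Real.rpow_add two_pos]
    field_simp
  have : Real.Gamma (α + 1) ≠ 0 := (Real.Gamma_pos_of_pos (by linarith)).ne'
  have : Real.Gamma (2 * α + 2) ≠ 0 := (Real.Gamma_pos_of_pos (by linarith)).ne'
  have : Real.Gamma (y + 1 : ℝ) ≠ 0 := (Real.Gamma_pos_of_pos (by positivity)).ne'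
  have : √Real.pi ≠ 0 := (Real.sqrt_pos.2 Real.pi_pos).ne'
  rw [limitScale, gegenbauerInvariant, abs_of_neg hα', Real.Gamma_one_half_eq, ← mul_assoc,
    div_mul_div_comm, div_mul_eq_mul_div, div_eq_div_iff (by positivity) (by positivity)]
  linear_combination
    -(gegenbauerWeight α y * Real.Gamma (-α) * Real.Gamma (y + 1)) * hdup

theorem tendsto_gegenbauerChain_green_div_rpow (hα : -1 < α) (hα' : α < 0) {l : ℝ} (hl : 0 < l)
    (x y : ℕ) :
    Tendsto (fun m : ℕ => (gegenbauerChain hα).green (Real.exp (-(l / m))) x y / (m : ℝ) ^ (-α))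
      atTop (𝓝 (limitScale α y * l⁻¹ ^ (-α))) := by
  have hL : Tendsto (fun m : ℕ => (m : ℝ) ^ (-α)) atTop atTop :=
    (tendsto_rpow_atTop (neg_pos.2 hα')).comp tendsto_natCast_atTop_atTop
  convert BirthDeathChain.tendsto_green (tendsto_exp_neg_div_natCast hl) hL
    (isReversible_gegenbauerInvariant hα) (gegenbauerInvariant_zero_right hα)
    (tendsto_gegenbauerChain_green_of_neg hα hα' hl) x y using 2
  rw [limitScale_eq_gegenbauerInvariant_mul hα hα', Real.mul_rpow two_pos.le hl.le,
    Real.inv_rpow hl.le, Real.rpow_neg hl.le, inv_inv]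
  ring

theorem tendsto_gegenbauerChain_localTimePgf_of_neg (hα : -1 < α) (hα' : α < 0) {s : ℝ}
    (hs : 0 ≤ s) (x y : ℕ) :
    Tendsto (fun m : ℕ =>
      (gegenbauerChain hα).localTimePgf (Real.exp (-(s / (m : ℝ) ^ (-α)))) y m x) atTop
      (𝓝 (mittagLeffler (-α) (-(s * limitScale α y)))) := by
  have ha : 0 < -α := neg_pos.2 hα'
  set κ := s * limitScale α y with hκ
  have hκ₀ : 0 ≤ κ := mul_nonneg hs (limitScale_pos hα hα' y).le
  have hL : Tendsto (fun m : ℕ => (m : ℝ) ^ (-α)) atTop atTop :=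
    (tendsto_rpow_atTop ha).comp tendsto_natCast_atTop_atTop
  -- the Laplace transform of `t ↦ E(-κ t ^ (-α))` is a geometric series that converges beyond `l`
  set l := (κ + 1) ^ (-α)⁻¹ with hl
  have hl₀ : 0 < l := by positivity
  have hgeom (l' : ℝ) (hl' : l' ≥ l) : |-κ| * l'⁻¹ ^ (-α) < 1 := by
    have hl'₀ : 0 < l' := hl₀.trans_le hl'
    rw [abs_neg, abs_of_nonneg hκ₀, Real.inv_rpow hl'₀.le, ← div_eq_mul_inv,
      div_lt_one (by positivity)]
    calc κ < l ^ (-α) := by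
            rw [hl, Real.rpow_inv_rpow (by positivity) ha.ne']
            exact lt_add_one κ
      _ ≤ l' ^ (-α) := by gcongr
  have hcont : ContinuousAt (fun t : ℝ => mittagLeffler (-α) (-κ * t ^ (-α))) 1 :=
    (continuous_mittagLeffler ha).continuousAt.comp
      ((Real.continuousAt_rpow_const 1 _ (.inl one_ne_zero)).const_mul _)
  have hlim := BirthDeathChain.tendsto_localTimePgf_of_green (x := x) hl₀ hs hL
    (fun m => by positivity)
    (fun l' hl' x => tendsto_gegenbauerChain_green_div_rpow hα hα' (hl₀.trans_le hl') x y) hcont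
    (fun l' hl' => integrableOn_exp_neg_mul_mittagLeffler ha (hl₀.trans_le hl') (hgeom l' hl'))
    fun l' hl' => by
      rw [integral_exp_neg_mul_mittagLeffler ha (hl₀.trans_le hl') (hgeom l' hl'), neg_mul,
        sub_neg_eq_add, hκ, mul_assoc]
  simpa only [Real.one_rpow, mul_one] using hlim

theorem gegenbauerInvariant_zero_left (y : ℕ) : gegenbauerInvariant 0 y = 2 * y + 1 := by
  have hy : Real.Gamma (y + 1 : ℝ) ≠ 0 := (Real.Gamma_pos_of_pos (by positivity)).ne'
  rw [gegenbauerInvariant, gegenbauerWeight, if_neg (by positivity)]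
  simp [hy]

theorem tendsto_gegenbauerChain_green_div_log {l : ℝ} (hl : 0 < l) (x y : ℕ) :
    Tendsto (fun m : ℕ =>
      (gegenbauerChain neg_one_lt_zero).green (Real.exp (-(l / m))) x y / Real.log m)
      atTop (𝓝 ((2 * y + 1) / 2)) := by
  convert BirthDeathChain.tendsto_green (tendsto_exp_neg_div_natCast hl) tendsto_log_natCast_atTop
    (isReversible_gegenbauerInvariant neg_one_lt_zero)
    (gegenbauerInvariant_zero_right neg_one_lt_zero)
    (tendsto_gegenbauerChain_green_of_zero hl) x y using 2
  rw [gegenbauerInvariant_zero_left, mul_one_div]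

theorem tendsto_gegenbauerChain_localTimePgf_of_zero {s : ℝ} (hs : 0 ≤ s) (x y : ℕ) :
    Tendsto (fun m : ℕ => (gegenbauerChain neg_one_lt_zero).localTimePgf
      (Real.exp (-(s / Real.log m))) y m x) atTop (𝓝 (1 + s * ((2 * y + 1) / 2))⁻¹) := by
  refine BirthDeathChain.tendsto_localTimePgf_of_green one_pos hs tendsto_log_natCast_atTop
    (c := fun _ => (2 * y + 1) / 2) (ψ := fun _ => (1 + s * ((2 * y + 1) / 2))⁻¹)
    (fun m => Real.log_natCast_nonneg m) (fun l hl x => ?_) continuousAt_const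
    (fun l hl => (hasAbelLimit_const (one_pos.trans_le hl) _).integrableOn) fun l hl => ?_
  · exact tendsto_gegenbauerChain_green_div_log (one_pos.trans_le hl) x y
  · rw [integral_mul_const, integral_exp_neg_mul (one_pos.trans_le hl)]

end GegenbauerLocalTime

section MarkovProperty

variable {Ω : Type*} [MeasurableSpace Ω] {P : Measure Ω} {S : ℕ → Ω → ℕ} {x : ℕ}

namespace IsMarkovChainFrom

section Transition

variable {p : ℕ → ℕ → ℝ} (hS : IsMarkovChainFrom p x P S)
include hS

theorem measurable_path (n : ℕ) : Measurable fun ω => fun k : Fin (n + 1) => S k ω :=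
  measurable_pi_lambda _ fun k => hS.measurable k

theorem measurable_localTime (n y : ℕ) : Measurable (localTime S n y) :=
  Finset.measurable_fun_sum _ fun k _ =>
    (Measurable.of_discrete (f := fun i : ℕ => if i = y then 1 else 0)).comp (hS.measurable k)

theorem map_path_succ_singleton (n : ℕ) (t : Fin (n + 1) → ℕ) (j : ℕ) :
    P.map (fun ω => (fun k : Fin (n + 1) => S k ω, S (n + 1) ω)) {(t, j)} =
      P.map (fun ω => fun k : Fin (n + 1) => S k ω) {t} *
        ENNReal.ofReal (p (t (Fin.last n)) j) := by
  let s : ℕ → ℕ := Function.extend Fin.val t fun _ => j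
  have hst (k : Fin (n + 1)) : s k = t k := Fin.val_injective.extend_apply ..
  have hsj : s (n + 1) = j := Function.extend_apply' _ _ _ fun ⟨k, hk⟩ => k.isLt.ne hk
  have hpath (ω : Ω) : (fun k : Fin (n + 1) => S k ω) = t ↔ ∀ k ≤ n, S k ω = s k := by
    simp only [funext_iff, ← hst, Fin.forall_iff, Nat.lt_succ_iff]
  have hpath_succ (ω : Ω) : ((fun k : Fin (n + 1) => S k ω) = t ∧ S (n + 1) ω = j) ↔
      ∀ k ≤ n + 1, S k ω = s k := by
    rw [hpath, ← hsj]
    simp only [Nat.le_succ_iff, or_imp, forall_and, forall_eq]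
  rw [Measure.map_apply ((hS.measurable_path n).prodMk (hS.measurable (n + 1))) (by measurability),
    Measure.map_apply (hS.measurable_path n) (by measurability)]
  simp only [Set.preimage, Set.mem_singleton_iff, Prod.mk.injEq, hpath_succ]
  simp only [hpath]
  rw [hS.markov n s, hsj, ← hst, Fin.val_last]

theorem lintegral_step (n : ℕ) (F : (Fin (n + 1) → ℕ) → ℝ≥0∞) (φ : ℕ → ℝ≥0∞) :
    ∫⁻ ω, F (fun k => S k ω) * φ (S (n + 1) ω) ∂P =
      ∫⁻ ω, F (fun k => S k ω) * ∑' j, ENNReal.ofReal (p (S n ω) j) * φ j ∂P := by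
  have hpath := hS.measurable_path n
  have hleft := lintegral_map (μ := P)
    (f := fun q : (Fin (n + 1) → ℕ) × ℕ => F q.1 * φ q.2) .of_discrete
    (hpath.prodMk (hS.measurable (n + 1)))
  have hright := lintegral_map (μ := P)
    (f := fun t => F t * ∑' j, ENNReal.ofReal (p (t (Fin.last n)) j) * φ j) .of_discrete hpath
  simp only [Fin.val_last] at hright
  rw [← hleft, ← hright, lintegral_countable', lintegral_countable', ENNReal.tsum_prod']
  refine tsum_congr fun t => ?_
  simp_rw [hS.map_path_succ_singleton]
  rw [← ENNReal.tsum_mul_left, ← ENNReal.tsum_mul_right]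
  refine tsum_congr fun j => ?_
  ring

end Transition

end IsMarkovChainFrom

namespace BirthDeathChain

/-- The transition probabilities `p(x, y)`. -/
noncomputable def transition (C : BirthDeathChain) (x y : ℕ) : ℝ := C.step (Pi.single y 1) x

theorem hasSum_transition_mul (C : BirthDeathChain) (f : ℕ → ℝ) (x : ℕ) :
    HasSum (fun y => C.transition x y * f y) (C.step f x) := by
  refine ((hasSum_pi_single (x + 1) (C.up x * f (x + 1))).add
    (hasSum_pi_single (x - 1) (C.down x * f (x - 1)))).congr_fun ?_
  intro y
  simp only [transition, step_apply, Pi.single_apply]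
  grind

theorem transition_nonneg (C : BirthDeathChain) (x y : ℕ) : 0 ≤ C.transition x y := by
  have h := C.step_mono (Pi.single_nonneg.2 zero_le_one : (0 : ℕ → ℝ) ≤ Pi.single y 1)
  rw [map_zero] at h
  exact h x

theorem ofReal_step (C : BirthDeathChain) {f : ℕ → ℝ} (hf : 0 ≤ f) (x : ℕ) :
    ENNReal.ofReal (C.step f x) =
      ∑' y, ENNReal.ofReal (C.transition x y) * ENNReal.ofReal (f y) := by
  have hsum := C.hasSum_transition_mul f x
  rw [← hsum.tsum_eq, ENNReal.ofReal_tsum_of_nonneg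
    (fun y => mul_nonneg (C.transition_nonneg x y) (hf y)) hsum.summable]
  simp_rw [ENNReal.ofReal_mul (C.transition_nonneg x _)]

end BirthDeathChain

namespace IsMarkovChainFrom

variable {C : BirthDeathChain} (hS : IsMarkovChainFrom C.transition x P S)
include hS

theorem lintegral_prod_mul_feynmanKac [IsProbabilityMeasure P] {r : ℕ → ℝ} (hr : 0 ≤ r)
    (n k : ℕ) :
    ∫⁻ ω, (∏ i ∈ Finset.range n, ENNReal.ofReal (r (S i ω))) *
      ENNReal.ofReal (C.feynmanKac r k (S n ω)) ∂P = ENNReal.ofReal (C.feynmanKac r (n + k) x) := by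
  induction n generalizing k with
  | zero =>
    have hstart : ∀ᵐ ω ∂P, (∏ i ∈ Finset.range 0, ENNReal.ofReal (r (S i ω))) *
        ENNReal.ofReal (C.feynmanKac r k (S 0 ω)) = ENNReal.ofReal (C.feynmanKac r k x) := by
      filter_upwards [hS.start] with ω hω
      rw [Finset.prod_range_zero, one_mul, hω]
    rw [lintegral_congr_ae hstart, lintegral_const, measure_univ, mul_one, zero_add]
  | succ n ih =>
    have hstep := hS.lintegral_step n (fun t => ∏ i, ENNReal.ofReal (r (t i)))
      fun j => ENNReal.ofReal (C.feynmanKac r k j)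
    have hprod (ω : Ω) : ∏ i : Fin (n + 1), ENNReal.ofReal (r (S i ω)) =
        ∏ i ∈ Finset.range (n + 1), ENNReal.ofReal (r (S i ω)) :=
      Fin.prod_univ_eq_prod_range (fun i => ENNReal.ofReal (r (S i ω))) (n + 1)
    simp only [hprod] at hstep
    rw [hstep, add_right_comm, add_assoc, ← ih (k + 1)]
    refine lintegral_congr fun ω => ?_
    rw [Finset.prod_range_succ, mul_assoc, ← C.ofReal_step (C.feynmanKac_nonneg hr k),
      ← ENNReal.ofReal_mul (hr _)]
    rfl

theorem integral_prod_eq_feynmanKac [IsProbabilityMeasure P] {r : ℕ → ℝ} (hr : 0 ≤ r) (n : ℕ) :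
    ∫ ω, ∏ i ∈ Finset.range (n + 1), r (S i ω) ∂P = C.feynmanKac r n x := by
  have hmeas : Measurable fun ω => ∏ i ∈ Finset.range (n + 1), r (S i ω) :=
    Finset.measurable_fun_prod _ fun i _ => Measurable.of_discrete.comp (hS.measurable i)
  rw [integral_eq_lintegral_of_nonneg_ae (ae_of_all _ fun ω => Finset.prod_nonneg fun i _ => hr _)
    hmeas.aestronglyMeasurable, ← ENNReal.toReal_ofReal (C.feynmanKac_nonneg hr n x), ← add_zero n,
    ← hS.lintegral_prod_mul_feynmanKac hr]
  congr 1
  refine lintegral_congr fun ω => ?_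
  rw [ENNReal.ofReal_prod_of_nonneg fun i _ => hr _, Finset.prod_range_succ]
  rfl

theorem integral_pow_localTime [IsProbabilityMeasure P] {ρ : ℝ} (hρ : 0 ≤ ρ) (n y : ℕ) :
    ∫ ω, ρ ^ localTime S n y ω ∂P = C.localTimePgf ρ y n x := by
  rw [BirthDeathChain.localTimePgf,
    ← hS.integral_prod_eq_feynmanKac (BirthDeathChain.update_one_nonneg hρ y)]
  congr with ω
  simp only [localTime, ← Finset.prod_pow_eq_pow_sum, Function.update_apply, pow_ite, pow_one,
    pow_zero, Pi.one_apply]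

end IsMarkovChainFrom

theorem transition_gegenbauerChain {α : ℝ} (hα : -1 < α) :
    (gegenbauerChain hα).transition = gegenbauerTransition α := by
  ext x y
  rcases x with _ | x
  · simp [BirthDeathChain.transition, BirthDeathChain.step_zero, gegenbauerTransition,
      Pi.single_apply, eq_comm]
  · have hup : (x + 1 : ℝ) + 2 * α + 1 = x + 2 * α + 2 := by ring
    have hden : 2 * (x + 1 : ℝ) + 2 * α + 1 = 2 * x + 2 * α + 3 := by ring
    simp only [BirthDeathChain.transition, BirthDeathChain.step_succ, gegenbauerTransition,
      gegenbauerChain_up_succ, gegenbauerChain_down_succ, Pi.single_apply, Nat.cast_succ, hup, hden]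
    grind

end MarkovProperty

namespace BirthDeathChain

variable (C : BirthDeathChain)

/-- The law of the local time `Nₙ(y)` of the chain started from `x`, defined by its recursion in
`n`. It gives access to limits of local times without a construction of the process. -/
noncomputable def localTimeLaw (y : ℕ) : ℕ → ℕ → Measure ℕ
  | 0, x => .dirac (if x = y then 1 else 0)
  | n + 1, x =>
    (ENNReal.ofReal (C.up x) • localTimeLaw y n (x + 1) +
      ENNReal.ofReal (C.down x) • localTimeLaw y n (x - 1)).map (· + if x = y then 1 else 0)

instance isProbabilityMeasure_localTimeLaw (y n x : ℕ) :
    IsProbabilityMeasure (C.localTimeLaw y n x) := by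
  induction n generalizing x with
  | zero =>
    rw [localTimeLaw]
    infer_instance
  | succ n ih =>
    have hmix : IsProbabilityMeasure (ENNReal.ofReal (C.up x) • C.localTimeLaw y n (x + 1) +
        ENNReal.ofReal (C.down x) • C.localTimeLaw y n (x - 1)) := by
      constructor
      simp only [Measure.add_apply, Measure.smul_apply, measure_univ, smul_eq_mul, mul_one]
      rw [← ENNReal.ofReal_add (C.up_pos x).le (C.down_nonneg x), C.up_add_down, ENNReal.ofReal_one]
    rw [localTimeLaw]
    exact Measure.isProbabilityMeasure_map .of_discrete

theorem integral_pow_localTimeLaw {ρ : ℝ} (hρ₀ : 0 ≤ ρ) (hρ₁ : ρ ≤ 1) (n y x : ℕ) :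
    ∫ k, ρ ^ k ∂C.localTimeLaw y n x = C.localTimePgf ρ y n x := by
  induction n generalizing x with
  | zero =>
    rw [localTimeLaw, integral_dirac, localTimePgf, feynmanKac, Function.update_apply, pow_ite,
      pow_one, pow_zero, Pi.one_apply]
  | succ n ih =>
    set d := if x = y then 1 else 0 with hd
    have hint (x' : ℕ) : Integrable (fun k => ρ ^ (k + d)) (C.localTimeLaw y n x') := by
      refine .of_bound .of_discrete 1 (ae_of_all _ fun k => ?_)
      rw [Real.norm_of_nonneg (pow_nonneg hρ₀ _)]
      exact pow_le_one₀ hρ₀ hρ₁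
    have hpow (x' : ℕ) :
        ∫ k, ρ ^ (k + d) ∂C.localTimeLaw y n x' = ρ ^ d * C.localTimePgf ρ y n x' := by
      simp_rw [pow_add, integral_mul_const, ih, mul_comm]
    have hρd : ρ ^ d = Function.update (1 : ℕ → ℝ) y ρ x := by
      rw [hd, Function.update_apply, pow_ite, pow_one, pow_zero, Pi.one_apply]
    rw [localTimeLaw, integral_map .of_discrete .of_discrete,
      integral_add_measure ((hint _).smul_measure ENNReal.ofReal_ne_top)
        ((hint _).smul_measure ENNReal.ofReal_ne_top),
      integral_smul_measure, integral_smul_measure, hpow, hpow, hρd,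
      ENNReal.toReal_ofReal (C.up_pos x).le, ENNReal.toReal_ofReal (C.down_nonneg x)]
    simp only [localTimePgf, feynmanKac, Pi.mul_apply, step_apply, smul_eq_mul]
    ring

end BirthDeathChain

section LimitLaws

section PgfToLaw

variable {Ω : Type*} [MeasurableSpace Ω] {N : ℕ → Ω → ℕ} (hN : ∀ n, Measurable (N n))
  {L : ℕ → ℝ} (hL : ∀ n, 0 ≤ L n) {φ : ℝ → ℝ} (hφ₀ : Tendsto φ (𝓝[>] 0) (𝓝 1))
include hN hL hφ₀

theorem exists_tendsto_map_div_of_pgf_tendsto {P : ℕ → Measure Ω} [∀ n, IsProbabilityMeasure (P n)]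
    (hφ : ∀ s, 0 < s →
      Tendsto (fun n => ∫ ω, Real.exp (-(s / L n)) ^ N n ω ∂P n) atTop (𝓝 (φ s))) :
    ∃ ν : ProbabilityMeasure ℝ, (∀ᵐ t ∂(ν : Measure ℝ), 0 ≤ t) ∧
      (∀ s, 0 < s → ∫ t, Real.exp (-s * t) ∂(ν : Measure ℝ) = φ s) ∧
      Tendsto (β := ProbabilityMeasure ℝ) (fun n => ⟨(P n).map fun ω => (N n ω : ℝ) / L n,
        Measure.isProbabilityMeasure_map (by fun_prop)⟩) atTop (𝓝 ν) := by
  refine exists_tendsto_of_laplace_tendsto (fun n => ?_) (fun s hs => ?_) hφ₀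
  · rw [ProbabilityMeasure.coe_mk, ae_map_iff (by fun_prop) measurableSet_Ici]
    exact ae_of_all _ fun ω => div_nonneg (Nat.cast_nonneg _) (hL n)
  · refine (hφ s hs).congr fun n => ?_
    rw [ProbabilityMeasure.coe_mk, integral_map (by fun_prop) (by fun_prop)]
    refine integral_congr_ae (ae_of_all _ fun ω => ?_)
    beta_reduce
    rw [← Real.exp_nat_mul, neg_mul, mul_neg, mul_div_left_comm]

theorem tendstoInDistribution_div_of_pgf_tendsto {P : Measure Ω} [IsProbabilityMeasure P]
    (hφ : ∀ s, 0 < s →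
      Tendsto (fun n => ∫ ω, Real.exp (-(s / L n)) ^ N n ω ∂P) atTop (𝓝 (φ s)))
    {Ω' : Type*} [MeasurableSpace Ω'] {P' : Measure Ω'} [IsProbabilityMeasure P'] {Z : Ω' → ℝ}
    (hZ : Measurable Z) (hZ₀ : ∀ᵐ ω ∂P', 0 ≤ Z ω)
    (hZφ : ∀ s, 0 < s → ∫ ω, Real.exp (-s * Z ω) ∂P' = φ s) :
    TendstoInDistribution (fun n ω => (N n ω : ℝ) / L n) atTop Z (fun _ => P) P' := by
  refine ⟨fun n => by fun_prop, hZ.aemeasurable, ?_⟩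
  obtain ⟨ν, hν₀, hν, hlim⟩ := exists_tendsto_map_div_of_pgf_tendsto hN hL hφ₀ hφ
  have := Measure.isProbabilityMeasure_map (μ := P') hZ.aemeasurable
  have hlaw : (ν : Measure ℝ) = P'.map Z := by
    refine ext_of_forall_laplace_nat_eq hν₀
      ((ae_map_iff hZ.aemeasurable measurableSet_Ici).2 hZ₀) fun n => ?_
    rcases n.eq_zero_or_pos with rfl | hn
    · simp
    · rw [hν n (by positivity), ← hZφ n (by positivity),
        integral_map hZ.aemeasurable (by fun_prop)]
  rwa [show ν = ⟨P'.map Z, this⟩ from Subtype.ext hlaw] at hlim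

end PgfToLaw

theorem isMittagLeffler_iff {a : ℝ} (ha : 0 < a) (M : ProbabilityMeasure ℝ) :
    IsMittagLeffler a M ↔ (∀ᵐ t ∂(M : Measure ℝ), 0 ≤ t) ∧
      ∀ s : ℝ, 0 ≤ s → ∫ t, Real.exp (-s * t) ∂(M : Measure ℝ) = mittagLeffler a (-s) :=
  and_congr_right fun _ => forall₂_congr fun s _ =>
    ⟨fun h => h.tsum_eq.symm, fun h => h ▸ (summable_mittagLeffler ha (-s)).hasSum⟩

theorem tendsto_mittagLeffler_neg_mul {a : ℝ} (ha : 0 < a) (c : ℝ) :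
    Tendsto (fun s => mittagLeffler a (-(s * c))) (𝓝[>] 0) (𝓝 1) := by
  have hcont : Continuous fun s : ℝ => mittagLeffler a (-(s * c)) :=
    (continuous_mittagLeffler ha).comp (by fun_prop)
  simpa [mittagLeffler_zero] using
    (hcont.tendsto 0).mono_left (nhdsWithin_le_nhds (s := Set.Ioi 0))

theorem IsMittagLeffler.unique {a : ℝ} {M M' : ProbabilityMeasure ℝ} (hM : IsMittagLeffler a M)
    (hM' : IsMittagLeffler a M') : M = M' :=
  ProbabilityMeasure.toMeasure_injective <| ext_of_forall_laplace_nat_eq hM.1 hM'.1 fun n =>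
    (hM.2 n n.cast_nonneg).unique (hM'.2 n n.cast_nonneg)

theorem exists_isMittagLeffler {a : ℝ} (ha : 0 < a) (ha' : a < 1) :
    ∃ M : ProbabilityMeasure ℝ, IsMittagLeffler a M := by
  -- up to scale, `M` is the limit law of the normalized local time at `0` for the index `-a`
  have hα : -1 < -a := neg_lt_neg ha'
  have hα' : -a < 0 := neg_neg_of_pos ha
  set c := limitScale (-a) 0
  have hc : 0 < c := limitScale_pos hα hα' 0
  obtain ⟨ν, hν₀, hν, -⟩ := exists_tendsto_map_div_of_pgf_tendsto (N := fun _ k : ℕ => k)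
    (P := fun n => (gegenbauerChain hα).localTimeLaw 0 n 0) (L := fun n => (n : ℝ) ^ a)
    (fun _ => .of_discrete) (fun n => by positivity) (tendsto_mittagLeffler_neg_mul ha c)
    fun s hs => by
      have hlim := tendsto_gegenbauerChain_localTimePgf_of_neg hα hα' hs.le 0 0
      rw [neg_neg] at hlim
      refine hlim.congr fun n => ?_
      rw [BirthDeathChain.integral_pow_localTimeLaw _ (Real.exp_pos _).le]
      exact Real.exp_le_one_iff.2 (neg_nonpos.2 (by positivity))
  have hdiv : AEMeasurable (fun t => t / c) (ν : Measure ℝ) := by fun_prop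
  refine ⟨ν.map hdiv, (isMittagLeffler_iff ha _).2 ⟨?_, fun s hs => ?_⟩⟩
  · rw [ProbabilityMeasure.toMeasure_map, ae_map_iff hdiv measurableSet_Ici]
    filter_upwards [hν₀] with t ht
    positivity
  · rw [ProbabilityMeasure.toMeasure_map, integral_map hdiv (by fun_prop)]
    rcases hs.eq_or_lt with rfl | hs
    · simp [mittagLeffler_zero]
    · rw [← div_mul_cancel₀ s hc.ne', ← hν (s / c) (by positivity)]
      simp_rw [div_mul_cancel₀ s hc.ne', ← neg_div, div_mul_eq_mul_div, mul_div_assoc]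

theorem measurable_gammaPDF (a r : ℝ) : Measurable (gammaPDF a r) :=
  (measurable_gammaPDFReal a r).ennreal_ofReal

theorem ae_nonneg_expMeasure (r : ℝ) : ∀ᵐ t ∂expMeasure r, 0 ≤ t := by
  rw [expMeasure, gammaMeasure, ae_withDensity_iff (measurable_gammaPDF 1 r)]
  refine ae_of_all _ fun t ht => ?_
  contrapose! ht
  exact gammaPDF_of_neg ht

theorem laplace_expMeasure {r s : ℝ} (hr : 0 < r) (hs : -r < s) :
    ∫ t, Real.exp (-s * t) ∂expMeasure r = r / (r + s) := by
  have hdensity (t : ℝ) : (gammaPDF 1 r t).toReal • Real.exp (-s * t) =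
      (Set.Ici (0 : ℝ)).indicator (fun t => r * Real.exp (-(r + s) * t)) t := by
    rcases le_or_gt 0 t with ht | ht
    · rw [show gammaPDF 1 r t = _ from exponentialPDF_of_nonneg ht,
        Set.indicator_of_mem (Set.mem_Ici.2 ht),
        ENNReal.toReal_ofReal (by positivity), smul_eq_mul, mul_assoc, ← Real.exp_add]
      ring_nf
    · rw [gammaPDF_of_neg ht, Set.indicator_of_notMem (Set.notMem_Ici.2 ht), ENNReal.toReal_zero,
        zero_smul]
  rw [expMeasure, gammaMeasure, integral_withDensity_eq_integral_toReal_smul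
    (measurable_gammaPDF 1 r) (ae_of_all _ fun _ => ENNReal.ofReal_lt_top)]
  simp_rw [hdensity]
  rw [integral_indicator measurableSet_Ici, integral_Ici_eq_integral_Ioi, integral_const_mul,
    integral_exp_mul_Ioi (by linarith), mul_zero, Real.exp_zero, neg_div_neg_eq, mul_one_div]

end LimitLaws

section LocalTimeLimits

theorem tendsto_inv_one_add_mul (c : ℝ) :
    Tendsto (fun s : ℝ => (1 + s * c)⁻¹) (𝓝[>] 0) (𝓝 1) := by
  have hcont : ContinuousAt (fun s : ℝ => (1 + s * c)⁻¹) 0 :=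
    ContinuousAt.inv₀ (by fun_prop) (by simp)
  simpa using hcont.tendsto.mono_left (nhdsWithin_le_nhds (s := Set.Ioi 0))

variable {Ω : Type*} [MeasurableSpace Ω] {P : Measure Ω} [IsProbabilityMeasure P] {x : ℕ}
  {S : ℕ → Ω → ℕ}

theorem tendstoInDistribution_localTime_of_neg {α : ℝ} (hα : -1 < α) (hα' : α < 0)
    (hS : IsMarkovChainFrom (gegenbauerTransition α) x P S) (y : ℕ) {M : ProbabilityMeasure ℝ}
    (hM : IsMittagLeffler (-α) M) :
    TendstoInDistribution (fun n ω => (localTime S n y ω : ℝ) / (n : ℝ) ^ (-α)) atTop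
      (fun t => limitScale α y * t) (fun _ => P) (M : Measure ℝ) := by
  rw [← transition_gegenbauerChain hα] at hS
  have hc : 0 < limitScale α y := limitScale_pos hα hα' y
  obtain ⟨hM₀, hMφ⟩ := (isMittagLeffler_iff (neg_pos.2 hα') M).1 hM
  refine tendstoInDistribution_div_of_pgf_tendsto (hS.measurable_localTime · y)
    (fun n => by positivity) (tendsto_mittagLeffler_neg_mul (neg_pos.2 hα') (limitScale α y))
    (fun s hs => ?_) (by fun_prop) ?_ fun s hs => ?_
  · simp_rw [hS.integral_pow_localTime (Real.exp_pos _).le]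
    exact tendsto_gegenbauerChain_localTimePgf_of_neg hα hα' hs.le x y
  · filter_upwards [hM₀] with t ht
    positivity
  · rw [← hMφ _ (by positivity)]
    simp_rw [← mul_assoc, neg_mul]

theorem tendstoInDistribution_localTime_of_zero
    (hS : IsMarkovChainFrom (gegenbauerTransition 0) x P S) (y : ℕ) :
    TendstoInDistribution (fun n ω => (localTime S n y ω : ℝ) / Real.log n) atTop
      (fun t => t) (fun _ => P) (expMeasure (2 / (2 * (y : ℝ) + 1))) := by
  rw [← transition_gegenbauerChain neg_one_lt_zero] at hS
  have hr : 0 < 2 / (2 * (y : ℝ) + 1) := by positivity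
  refine tendstoInDistribution_div_of_pgf_tendsto (hS.measurable_localTime · y)
    (fun n => Real.log_natCast_nonneg n) (tendsto_inv_one_add_mul ((2 * y + 1) / 2))
    (fun s hs => ?_) measurable_id (ae_nonneg_expMeasure _) fun s hs => ?_
  · simp_rw [hS.integral_pow_localTime (Real.exp_pos _).le]
    exact tendsto_gegenbauerChain_localTimePgf_of_zero hs.le x y
  · rw [laplace_expMeasure hr ((neg_neg_of_pos hr).trans hs)]
    field_simp

end LocalTimeLimits

theorem proposition5p1_general :
    (∀ α : ℝ, -1 < α → α < 0 →
      (∃! M : ProbabilityMeasure ℝ, IsMittagLeffler |α| M) ∧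
      ∀ M : ProbabilityMeasure ℝ, IsMittagLeffler |α| M →
      ∀ (x y : ℕ) (Ω : Type*) [MeasurableSpace Ω] (P : Measure Ω) [IsProbabilityMeasure P]
        (S : ℕ → Ω → ℕ), IsMarkovChainFrom (gegenbauerTransition α) x P S →
        TendstoInDistribution
          (fun (n : ℕ) (ω : Ω) => (localTime S n y ω : ℝ) / (n : ℝ) ^ |α|) atTop
          (fun t : ℝ => limitScale α y * t) (fun _ => P) (M : Measure ℝ)) ∧
    (∀ (x y : ℕ) (Ω : Type*) [MeasurableSpace Ω] (P : Measure Ω) [IsProbabilityMeasure P]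
        (S : ℕ → Ω → ℕ), IsMarkovChainFrom (gegenbauerTransition 0) x P S →
        TendstoInDistribution
          (fun (n : ℕ) (ω : Ω) => (localTime S n y ω : ℝ) / Real.log n) atTop
          (fun t : ℝ => t) (fun _ => P) (expMeasure (2 / (2 * (y : ℝ) + 1)))) := by
  refine ⟨fun α hα hα' => ?_, fun x y Ω _ P _ S hS =>
    tendstoInDistribution_localTime_of_zero hS y⟩
  rw [abs_of_neg hα']
  obtain ⟨M, hM⟩ := exists_isMittagLeffler (neg_pos.2 hα') (neg_lt.1 hα)
  exact ⟨⟨M, hM, fun M' hM' => hM'.unique hM⟩, fun M hM x y Ω _ P _ S hS =>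
    tendstoInDistribution_localTime_of_neg hα hα' hS y hM⟩

theorem proposition5p1 :
    (∀ α : ℝ, -1 / 2 ≤ α → α < 0 →
      (∃! M : ProbabilityMeasure ℝ, IsMittagLeffler |α| M) ∧
      ∀ M : ProbabilityMeasure ℝ, IsMittagLeffler |α| M →
      ∀ (x y : ℕ) (Ω : Type*) [MeasurableSpace Ω] (P : Measure Ω) [IsProbabilityMeasure P]
        (S : ℕ → Ω → ℕ), IsMarkovChainFrom (gegenbauerTransition α) x P S →
        TendstoInDistribution
          (fun (n : ℕ) (ω : Ω) => (localTime S n y ω : ℝ) / (n : ℝ) ^ |α|) atTop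
          (fun t : ℝ => limitScale α y * t) (fun _ => P) (M : Measure ℝ)) ∧
    (∀ (x y : ℕ) (Ω : Type*) [MeasurableSpace Ω] (P : Measure Ω) [IsProbabilityMeasure P]
        (S : ℕ → Ω → ℕ), IsMarkovChainFrom (gegenbauerTransition 0) x P S →
        TendstoInDistribution
          (fun (n : ℕ) (ω : Ω) => (localTime S n y ω : ℝ) / Real.log n) atTop
          (fun t : ℝ => t) (fun _ => P) (expMeasure (2 / (2 * (y : ℝ) + 1)))) :=
  proposition5p1_general.imp_left fun h α hα => h α (by linarith)
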